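/- **Definitions.** For $s\ge 2$, a family of $s$ distinct sets $\{D_1,\dots,D_s\}$ is a *$\Delta$-system* with *center* $C$ if $D_i\cap D_j=C$ for all $i\ne j$. Let $\vec a=(a_1,\dots,a_p)$ and $\vec b=(b_1,\dots,b_p)$ be sequences of positive integers with $\sum_{i=1}^p a_i=k$. An *$(\vec a,\vec b)$-$\Delta$-system* is a collection of sets $\{E_0\}\cup\{E_i^j : 1\le i\le p,\ 1\le j\le b_i\}$ such that, for some partition $E_0=A_1\cup\dots\cup A_p$ into pairwise disjoint sets with $|A_i|=a_i$ for all $i$, the family $\{E_0,E_i^1,\dots,E_i^{b_i}\}$ is a $\Delta$-system with center $E_0\setminus A_i$ for every $i$, and such that the sets $E_i^j\setminus E_0$ ($1\le i\le p$, $1\le j\le b_i$) are pairwise disjoint. An *$(\vec a,d)$-$\Delta$-system* is an $(\vec a,\vec b)$-$\Delta$-system for some sequence $\vec b$ of positive integers with $\sum_{i=1}^p b_i=d$. A hypergraph is a *star* if all its edges contain a fixed vertex. **Theorem.** For all $k,d$ there is a number $n_0=n_0(k,d)$ such that the following holds. Let $k>p\ge 2$ and $d\ge p$, and let $\vec a=(a_1,\dots,a_p)$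 be a sequence of positive integers with $\sum_{i=1}^p a_i=k$. Let $n\ge n_0$ and let $\mathcal H\subset\binom{[n]}{k}$ be a $k$-uniform hypergraph on $[n]=\{1,\dots,n\}$ that contains no $(\vec a,d)$-$\Delta$-system as a subgraph (i.e. no subfamily of $\mathcal H$ is an $(\vec a,d)$-$\Delta$-system). Then $|\mathcal H|\le\binom{n-1}{k-1}$, and equality holds only if $\mathcal H$ is a star. -/

import Mathlib

/-- A sequence `D` of `s ≥ 2` (distinct) finite sets is a Δ-system (sunflower) with center `C`
if any two of its members meet exactly in `C`. -/
def IsDeltaSystem {α : Type*} [DecidableEq α] {s : ℕ} (D : Fin s → Finset α) (C : Finset α) :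
    Prop :=
  2 ≤ s ∧ Function.Injective D ∧ ∀ i j, i ≠ j → D i ∩ D j = C

/-- `A` is an `a`-partition of `E`: the sets `A 0, …, A (p - 1)` are pairwise disjoint, their union
is `E`, and `A i` has `a i` elements. -/
def IsVecPartition {α : Type*} [DecidableEq α] {p : ℕ} (a : Fin p → ℕ) (E : Finset α)
    (A : Fin p → Finset α) : Prop :=
  (∀ i j, i ≠ j → Disjoint (A i) (A j)) ∧ Finset.univ.biUnion A = E ∧ ∀ i, (A i).card = a i

/-- The sets `E₀` and `E i j` (for `i < p`, `j < b i`) form a semi-`(a, b)`-Δ-system with host `E₀`: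
for some `a`-partition `A` of `E₀`, each family `E₀, E i 0, …, E i (b i - 1)` is a Δ-system with
center `E₀ \ A i`. -/
def IsSemiVecDeltaSystem {α : Type*} [DecidableEq α] {p : ℕ} (a b : Fin p → ℕ) (E₀ : Finset α)
    (E : (i : Fin p) → Fin (b i) → Finset α) : Prop :=
  ∃ A : Fin p → Finset α, IsVecPartition a E₀ A ∧
    ∀ i, IsDeltaSystem (Fin.cons E₀ (E i) : Fin (b i + 1) → Finset α) (E₀ \ A i)

/-- An `(a, b)`-Δ-system is a semi-`(a, b)`-Δ-system in which all the sets `E i j \ E₀` are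
pairwise disjoint. -/
def IsVecDeltaSystem {α : Type*} [DecidableEq α] {p : ℕ} (a b : Fin p → ℕ) (E₀ : Finset α)
    (E : (i : Fin p) → Fin (b i) → Finset α) : Prop :=
  IsSemiVecDeltaSystem a b E₀ E ∧
    ∀ x y : (i : Fin p) × Fin (b i), x ≠ y → Disjoint (E x.1 x.2 \ E₀) (E y.1 y.2 \ E₀)

/-- The family `F` of sets is an `(a, d)`-Δ-system: it is the collection of the members of an
`(a, b)`-Δ-system for some sequence `b` of positive integers with sum `d`. -/
def IsVecNumDeltaSystem {α : Type*} [DecidableEq α] {p : ℕ} (a : Fin p → ℕ) (d : ℕ)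
    (F : Finset (Finset α)) : Prop :=
  ∃ b : Fin p → ℕ, (∀ i, 0 < b i) ∧ ∑ i, b i = d ∧
    ∃ (E₀ : Finset α) (E : (i : Fin p) → Fin (b i) → Finset α),
      IsVecDeltaSystem a b E₀ E ∧
        F = insert E₀ (Finset.univ.image fun x : (i : Fin p) × Fin (b i) => E x.1 x.2)

/-- A hypergraph is a star if some fixed vertex lies in all its edges. -/
def IsStar {α : Type*} (H : Finset (Finset α)) : Prop :=
  ∃ v : α, ∀ E ∈ H, v ∈ E

/-! ### Robust sets, and the vector Δ-systems they produce. -/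

section
open Finset

variable {α : Type*} [DecidableEq α]

/-! A set is robust if the edges through it cannot be blocked by `K = k * (d + 1)` outside vertices.
When an edge `E` is partitioned into parts `A i` with every `E \ A i` robust, a Δ-system can be
built greedily; some parts, though not all, may instead use prescribed edges
(`exists_vecNumDeltaSystem`).

All but O(n^(k-2)) edges have a core `M`: `E \ A` is robust whenever `A` is nonempty and |A ∩ M| ≠ 1
(`exists_core_of_forall_not_mem`). In a Δ-system-free `H` a core therefore cannot be distributed
over the parts without some part receiving exactly one core vertex, and in particular it is
nonempty. Give an edge `E` with a core the weight ∑ 1/deg(E \ x) over x ∈ E, with degrees counted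
among edges with cores. The total weight is at most C(n, k-1). A singleton core {x} forces weight at
least 1, because x cannot be exchanged, and a larger core forces 1 + 2/k. If |H| ≥ C(n-1, k-1),
which is C(n, k-1) up to O(n^(k-2)), then all but O(n^(k-2)) of the (k-1)-sets T extend to an edge
with core {f T} (`exists_core_vertices`).

An edge with core {x} never meets an edge avoiding x in k - a i vertices. For a part with a i ≥ 2
this links the values of f on different sets and makes f equal to one vertex x almost everywhere
(`exists_dominant_value`), so `H` is close to the full star at x.

It remains to remove the set B of edges avoiding x. By the lower bound on |H|, there are at most |B|
missing edges through x. Each (k - a i)-subset of an edge of B accounts for about n^(a i - 1)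
missing edges (`card_shadow_mul_pow_le`), while |B| ≤ K|∂B| (`VecFree.card_le_mul_card_shadow`).
Kruskal–Katona turns this into a bound on n (`le_of_card_shadow_le`), so B is empty for large n. -/

/-- `Q` is `K`-robust in `H` if no set of at most `K` vertices outside `Q` meets every edge of `H`
containing `Q`. -/
def Robust (H : Finset (Finset α)) (K : ℕ) (Q : Finset α) : Prop :=
  ∀ Z : Finset α, Z.card ≤ K → Disjoint Z Q → ∃ F ∈ H, Q ⊆ F ∧ Disjoint F Z

/-- `H` contains no `(a, d)`-Δ-system. -/
def VecFree {p : ℕ} (a : Fin p → ℕ) (d : ℕ) (H : Finset (Finset α)) : Prop :=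
  ¬ ∃ F : Finset (Finset α), F ⊆ H ∧ IsVecNumDeltaSystem a d F

theorem VecFree.mono {p : ℕ} {a : Fin p → ℕ} {d : ℕ} {G H : Finset (Finset α)}
    (hH : VecFree a d H) (hGH : G ⊆ H) : VecFree a d G := by
  rintro ⟨F, hF, h⟩
  exact hH ⟨F, hF.trans hGH, h⟩

/-- Robust subsets of `E` extend to edges meeting `E` in prescribed sets and pairwise disjoint
outside `E`, also in the presence of some edges chosen beforehand. -/
theorem exists_disjoint_extensions {H : Finset (Finset α)} {k K : ℕ} (hH : ∀ F ∈ H, F.card = k)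
    {E : Finset α} (hE : E.card = k) {ι : Type*} [DecidableEq ι] (Q : ι → Finset α)
    (hQ : ∀ x, Q x ⊆ E) (T₀ : Finset ι) (F₀ : ι → Finset α)
    (h₀ : ∀ x ∈ T₀, F₀ x ∈ H ∧ F₀ x ∩ E = Q x)
    (h₀d : ∀ x ∈ T₀, ∀ y ∈ T₀, x ≠ y → Disjoint (F₀ x \ E) (F₀ y \ E))
    (hR : ∀ x, x ∉ T₀ → Robust H K (Q x)) (T : Finset ι) (hK : k + (T₀ ∪ T).card * k ≤ K) :
    ∃ F : ι → Finset α, (∀ x ∈ T₀ ∪ T, F x ∈ H ∧ F x ∩ E = Q x) ∧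
      ∀ x ∈ T₀ ∪ T, ∀ y ∈ T₀ ∪ T, x ≠ y → Disjoint (F x \ E) (F y \ E) := by
  induction T using Finset.induction_on with
  | empty => exact ⟨F₀, by simpa using h₀, by simpa using h₀d⟩
  | insert x T hx ih =>
    have hle : (T₀ ∪ T).card ≤ (T₀ ∪ insert x T).card :=
      card_le_card (union_subset_union_right (subset_insert _ _))
    obtain ⟨F, hF, hFd⟩ := ih (le_trans (by gcongr) hK)
    by_cases hx0 : x ∈ T₀ ∪ T
    · have : T₀ ∪ insert x T = T₀ ∪ T := by
        rw [union_insert, insert_eq_of_mem hx0]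
      rw [this]
      exact ⟨F, hF, hFd⟩
    -- Avoiding `E \ Q x` makes the trace on `E` exactly `Q x`; avoiding the earlier edges outside
    -- `E` gives disjointness. Each of these sets costs at most `k` vertices.
    · have hZ : ((E \ Q x) ∪ (T₀ ∪ T).biUnion fun y => F y \ E).card ≤ K := by
        refine le_trans (card_union_le _ _) (le_trans (add_le_add ?_ ?_) hK)
        · exact (card_le_card sdiff_subset).trans hE.le
        · refine card_biUnion_le.trans ?_
          refine (sum_le_card_nsmul _ _ k fun y hy => ?_).trans ?_
          · exact (card_le_card sdiff_subset).trans (hH _ (hF y hy).1).le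
          · simpa using Nat.mul_le_mul_right k hle
      have hxT : x ∉ T₀ := fun h => hx0 (mem_union_left _ h)
      obtain ⟨G, hG, hQG, hGZ⟩ := hR x hxT _ hZ (by
        rw [disjoint_union_left, disjoint_biUnion_left]
        exact ⟨sdiff_disjoint, fun y _ => disjoint_of_subset_right (hQ x) sdiff_disjoint⟩)
      rw [disjoint_union_right, disjoint_biUnion_right] at hGZ
      have hGE : G ∩ E = Q x := by
        ext v
        constructor
        · intro hv
          by_contra hvQ
          rw [mem_inter] at hv
          exact disjoint_left.1 hGZ.1 hv.1 (mem_sdiff.2 ⟨hv.2, hvQ⟩)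
        · exact fun hv => mem_inter.2 ⟨hQG hv, hQ x hv⟩
      have hne : ∀ y ∈ T₀ ∪ T, y ≠ x := fun y hy h => hx0 (h ▸ hy)
      have hGd : ∀ y ∈ T₀ ∪ T, Disjoint (G \ E) (F y \ E) := fun y hy =>
        disjoint_of_subset_left sdiff_subset (hGZ.2 y hy)
      refine ⟨Function.update F x G, ?_, ?_⟩
      · intro y hy
        rw [union_insert, mem_insert] at hy
        rcases hy with rfl | hy
        · simpa using ⟨hG, hGE⟩
        · simpa [Function.update_of_ne (hne y hy)] using hF y hy
      · intro y hy z hz hyz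
        rw [union_insert, mem_insert] at hy hz
        rcases hy with rfl | hy
        · rcases hz with rfl | hz
          · exact absurd rfl hyz
          · simpa [Function.update_of_ne (hne z hz)] using hGd z hz
        · rcases hz with rfl | hz
          · simpa [Function.update_of_ne (hne y hy)] using (hGd y hy).symm
          · simpa [Function.update_of_ne (hne y hy), Function.update_of_ne (hne z hz)]
              using hFd y hy z hz hyz

/-- A host edge `E` with a vector partition `A`, some of whose parts `A i` are realised by given
edges `G i` and the others (at least one) by robust sets, produces a vector Δ-system. -/
theorem exists_vecNumDeltaSystem {H : Finset (Finset α)} {k d p : ℕ} {a : Fin p → ℕ}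
    (hH : ∀ F ∈ H, F.card = k) (ha : ∀ i, 0 < a i) (hd : p ≤ d) {E : Finset α} (hE : E ∈ H)
    {A : Fin p → Finset α} (hA : IsVecPartition a E A) {I : Finset (Fin p)} (hI : ∃ i, i ∉ I)
    (G : Fin p → Finset α) (hG : ∀ i ∈ I, G i ∈ H ∧ G i ∩ E = E \ A i)
    (hGd : ∀ i ∈ I, ∀ j ∈ I, i ≠ j → Disjoint (G i \ E) (G j \ E))
    (hR : ∀ i, i ∉ I → Robust H (k * (d + 1)) (E \ A i)) : ¬ VecFree a d H := by
  obtain ⟨i₀, hi₀⟩ := hI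
  have hp : 0 < p := i₀.pos
  -- One edge per part, with the whole surplus `d - p` put on `i₀`: its set is robust, so it can be
  -- realised any number of times.
  set b : Fin p → ℕ := Function.update (fun _ => 1) i₀ (d - p + 1) with hb
  have hbpos : ∀ i, 0 < b i := by
    intro i
    by_cases h : i = i₀
    · subst h; simp [hb]
    · simp [hb, Function.update_of_ne h]
  have hbsum : ∑ i, b i = d := by
    rw [hb, sum_update_of_mem (mem_univ _)]
    simp only [sum_const, smul_eq_mul, mul_one]
    rw [card_sdiff_of_subset (subset_univ _)]
    simp
    omega
  have hbI : ∀ i ∈ I, b i = 1 := by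
    intro i hi
    have : i ≠ i₀ := fun h => hi₀ (h ▸ hi)
    simp [hb, Function.update_of_ne this]
  have hcard : Fintype.card ((i : Fin p) × Fin (b i)) = d := by simp [hbsum]
  obtain ⟨F, hF, hFd⟩ := exists_disjoint_extensions (K := k * (d + 1)) hH (hH E hE)
    (ι := (i : Fin p) × Fin (b i)) (fun x => E \ A x.1) (fun x => sdiff_subset)
    (univ.filter fun x => x.1 ∈ I) (fun x => G x.1)
    (by intro x hx; exact hG _ (by simpa using hx))
    (by
      intro x hx y hy hxy
      simp only [mem_filter, mem_univ, true_and] at hx hy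
      apply hGd _ hx _ hy
      intro h
      apply hxy
      obtain ⟨i, u⟩ := x
      obtain ⟨j, v⟩ := y
      simp only at h hx
      subst h
      have := hbI i hx
      have h1 := u.2
      have h2 := v.2
      congr
      exact Fin.ext (by omega))
    (by intro x hx; exact hR _ (by simpa using hx)) univ
    (by rw [union_eq_right.2 (subset_univ _), card_univ, hcard]; nlinarith)
  simp only [union_eq_right.2 (subset_univ _), mem_univ, forall_const] at hF hFd
  obtain ⟨hAd, hAU, hAc⟩ := hA
  have hAsub : ∀ i, A i ⊆ E := fun i => hAU ▸ subset_biUnion_of_mem A (mem_univ i)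
  have hnotsub : ∀ x, ¬ F x ⊆ E := by
    intro x hx
    have h1 : F x = E := eq_of_subset_of_card_le hx (by rw [hH _ hE, hH _ (hF x).1])
    have h2 := (hF x).2
    rw [h1, inter_self] at h2
    have h3 := ha x.1
    rw [← hAc x.1, card_pos] at h3
    obtain ⟨v, hv⟩ := h3
    have := hAsub _ hv
    rw [h2] at this
    exact (mem_sdiff.1 this).2 hv
  have hinter : ∀ x y, x ≠ y → x.1 = y.1 → F x ∩ F y = E \ A x.1 := by
    intro x y hxy h1
    have hx := (hF x).2
    have hy := (hF y).2
    rw [← h1] at hy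
    ext v
    constructor
    · intro hv
      rw [mem_inter] at hv
      by_cases hvE : v ∈ E
      · rw [← hx]; exact mem_inter.2 ⟨hv.1, hvE⟩
      · exact absurd (mem_sdiff.2 ⟨hv.2, hvE⟩)
          (disjoint_left.1 (hFd x y hxy) (mem_sdiff.2 ⟨hv.1, hvE⟩))
    · intro hv
      have h2 := hv
      rw [← hx] at h2
      rw [← hy] at hv
      exact mem_inter.2 ⟨(mem_inter.1 h2).1, (mem_inter.1 hv).1⟩
  have hinj : ∀ x y, x ≠ y → F x ≠ F y := by
    intro x y hxy h
    have := hFd x y hxy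
    rw [h, disjoint_self] at this
    exact hnotsub y (sdiff_eq_empty_iff_subset.1 this)
  intro hfree
  apply hfree
  refine ⟨insert E (univ.image fun x : (i : Fin p) × Fin (b i) => F x), ?_, b, hbpos, hbsum, E,
    fun i j => F ⟨i, j⟩, ⟨⟨A, ⟨hAd, hAU, hAc⟩, ?_⟩, ?_⟩, rfl⟩
  · intro X hX
    rw [mem_insert, mem_image] at hX
    rcases hX with rfl | ⟨x, -, rfl⟩
    · exact hE
    · exact (hF x).1
  · intro i
    refine ⟨by have := hbpos i; omega, ?_, ?_⟩
    · rw [Fin.cons_injective_iff]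
      refine ⟨?_, ?_⟩
      · rintro ⟨j, hj⟩
        exact hnotsub ⟨i, j⟩ hj.subset
      · intro j j' h
        by_contra hne
        exact hinj ⟨i, j⟩ ⟨i, j'⟩ (by simpa using hne) h
    · intro j j'
      refine Fin.cases ?_ (fun j => ?_) j <;> refine Fin.cases ?_ (fun j' => ?_) j'
      · exact fun h => absurd rfl h
      · intro _
        simp only [Fin.cons_zero, Fin.cons_succ]
        rw [inter_comm]
        exact (hF ⟨i, j'⟩).2
      · intro _
        simp only [Fin.cons_zero, Fin.cons_succ]
        exact (hF ⟨i, j⟩).2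
      · intro h
        simp only [Fin.cons_succ]
        refine hinter ⟨i, j⟩ ⟨i, j'⟩ ?_ rfl
        intro h'
        apply h
        simpa using h'
  · intro x y hxy
    exact hFd x y hxy

/-- A finite set splits into pieces of prescribed sizes. -/
theorem exists_partition_of_sum {ι : Type*} [DecidableEq ι] (J : Finset ι) (c : ι → ℕ)
    (S : Finset α) (hS : ∑ i ∈ J, c i = S.card) :
    ∃ B : ι → Finset α, (∀ i ∈ J, ∀ j ∈ J, i ≠ j → Disjoint (B i) (B j)) ∧ J.biUnion B = S ∧
      ∀ i ∈ J, (B i).card = c i := by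
  induction J using Finset.induction_on generalizing S with
  | empty => exact ⟨fun _ => ∅, by simp, by simpa using (card_eq_zero.1 (by simpa using hS.symm)).symm,
      by simp⟩
  | insert x J hx ih =>
    rw [sum_insert hx] at hS
    obtain ⟨X, hX, hXc⟩ := exists_subset_card_eq (s := S) (n := c x) (by omega)
    obtain ⟨B, hB, hBU, hBc⟩ := ih (S \ X) (by rw [card_sdiff_of_subset hX]; omega)
    have hne : ∀ y ∈ J, y ≠ x := fun y hy h => hx (h ▸ hy)
    have hdis : ∀ y ∈ J, Disjoint X (B y) := fun y hy =>
      disjoint_of_subset_right (hBU ▸ subset_biUnion_of_mem B hy) disjoint_sdiff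
    refine ⟨Function.update B x X, ?_, ?_, ?_⟩
    · intro y hy z hz hyz
      rw [mem_insert] at hy hz
      rcases hy with rfl | hy
      · rcases hz with rfl | hz
        · exact absurd rfl hyz
        · simpa [Function.update_of_ne (hne z hz)] using hdis z hz
      · rcases hz with rfl | hz
        · simpa [Function.update_of_ne (hne y hy)] using (hdis y hy).symm
        · simpa [Function.update_of_ne (hne y hy), Function.update_of_ne (hne z hz)]
            using hB y hy z hz hyz
    · rw [biUnion_insert, Function.update_self]
      have : J.biUnion (Function.update B x X) = J.biUnion B :=
        biUnion_congr rfl fun y hy => Function.update_of_ne (hne y hy) _ _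
      rw [this, hBU, union_sdiff_of_subset hX]
    · intro y hy
      rw [mem_insert] at hy
      rcases hy with rfl | hy
      · simpa using hXc
      · simpa [Function.update_of_ne (hne y hy)] using hBc y hy

/-- A partial vector partition of `E` (its parts with index in `I`) extends to a vector partition
whose other parts meet `M` in prescribed numbers of elements. -/
theorem exists_vecPartition_extension {p : ℕ} {a : Fin p → ℕ} {E M : Finset α} (hME : M ⊆ E)
    (hsum : ∑ i, a i = E.card) (I : Finset (Fin p)) (A₀ : Fin p → Finset α)
    (hA₀ : ∀ i ∈ I, A₀ i ⊆ E ∧ (A₀ i).card = a i)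
    (hA₀d : ∀ i ∈ I, ∀ j ∈ I, i ≠ j → Disjoint (A₀ i) (A₀ j)) (μ : Fin p → ℕ)
    (hμ : ∀ i, i ∉ I → μ i ≤ a i) (hμs : ∑ i ∈ Iᶜ, μ i = (M \ I.biUnion A₀).card) :
    ∃ A : Fin p → Finset α, IsVecPartition a E A ∧ (∀ i ∈ I, A i = A₀ i) ∧
      ∀ i, i ∉ I → (A i ∩ M).card = μ i := by
  set U := I.biUnion A₀ with hU
  have hUE : U ⊆ E := biUnion_subset.2 fun i hi => (hA₀ i hi).1
  have hUc : U.card = ∑ i ∈ I, a i := by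
    rw [hU, card_biUnion hA₀d]
    exact sum_congr rfl fun i hi => (hA₀ i hi).2
  have hsplit : ∑ i ∈ I, a i + ∑ i ∈ Iᶜ, a i = E.card := by rw [sum_add_sum_compl, hsum]
  have hc : ∑ i ∈ Iᶜ, (a i - μ i) = ((E \ U) \ M).card := by
    have h1 : ∑ i ∈ Iᶜ, (a i - μ i) + ∑ i ∈ Iᶜ, μ i = ∑ i ∈ Iᶜ, a i := by
      rw [← sum_add_distrib]
      exact sum_congr rfl fun i hi => Nat.sub_add_cancel (hμ i (mem_compl.1 hi))
    have h2 : ((E \ U) \ M).card + (M \ U).card = (E \ U).card := by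
      have : M \ U = (E \ U) ∩ M := by
        ext v; simp only [mem_sdiff, mem_inter]
        exact ⟨fun h => ⟨⟨hME h.1, h.2⟩, h.1⟩, fun h => ⟨h.2, h.1.2⟩⟩
      rw [this, card_sdiff_add_card_inter]
    have h3 := card_sdiff_of_subset hUE
    have h4 := card_le_card hUE
    omega
  obtain ⟨B, hBd, hBU, hBc⟩ := exists_partition_of_sum Iᶜ μ (M \ U) hμs
  obtain ⟨C, hCd, hCU, hCc⟩ := exists_partition_of_sum Iᶜ (fun i => a i - μ i) _ hc
  have hBM : ∀ i, i ∉ I → B i ⊆ M \ U := fun i hi =>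
    hBU ▸ subset_biUnion_of_mem B (mem_compl.2 hi)
  have hCM : ∀ i, i ∉ I → C i ⊆ (E \ U) \ M := fun i hi =>
    hCU ▸ subset_biUnion_of_mem C (mem_compl.2 hi)
  have hBC : ∀ i j, i ∉ I → j ∉ I → Disjoint (B i) (C j) := fun i j hi hj =>
    disjoint_of_subset_left ((hBM i hi).trans sdiff_subset)
      (disjoint_of_subset_right (hCM j hj) disjoint_sdiff)
  have hnotU : ∀ i, i ∉ I → Disjoint U (B i ∪ C i) := fun i hi => by
    rw [disjoint_union_right]
    exact ⟨disjoint_of_subset_right (hBM i hi) disjoint_sdiff,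
      disjoint_of_subset_right ((hCM i hi).trans sdiff_subset) disjoint_sdiff⟩
  have hA₀U : ∀ i ∈ I, A₀ i ⊆ U := fun i hi => subset_biUnion_of_mem A₀ hi
  refine ⟨fun i => if i ∈ I then A₀ i else B i ∪ C i, ⟨?_, ?_, ?_⟩, ?_, ?_⟩
  · intro i j hij
    by_cases hi : i ∈ I <;> by_cases hj : j ∈ I <;> simp only [hi, hj, if_true, if_false]
    · exact hA₀d i hi j hj hij
    · exact disjoint_of_subset_left (hA₀U i hi) (hnotU j hj)
    · exact (disjoint_of_subset_left (hA₀U j hj) (hnotU i hi)).symm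
    · rw [disjoint_union_left, disjoint_union_right, disjoint_union_right]
      exact ⟨⟨hBd i (mem_compl.2 hi) j (mem_compl.2 hj) hij, hBC i j hi hj⟩,
        (hBC j i hj hi).symm, hCd i (mem_compl.2 hi) j (mem_compl.2 hj) hij⟩
  · ext v
    simp only [mem_biUnion, mem_univ, true_and]
    constructor
    · rintro ⟨i, hv⟩
      by_cases hi : i ∈ I
      · rw [if_pos hi] at hv
        exact (hA₀ i hi).1 hv
      · rw [if_neg hi, mem_union] at hv
        rcases hv with hv | hv
        · exact hME (mem_sdiff.1 (hBM i hi hv)).1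
        · exact (mem_sdiff.1 (mem_sdiff.1 (hCM i hi hv)).1).1
    · intro hv
      by_cases hvU : v ∈ U
      · obtain ⟨i, hi, hvi⟩ := mem_biUnion.1 hvU
        exact ⟨i, by rwa [if_pos hi]⟩
      · by_cases hvM : v ∈ M
        · have : v ∈ Iᶜ.biUnion B := by rw [hBU]; exact mem_sdiff.2 ⟨hvM, hvU⟩
          obtain ⟨i, hi, hvi⟩ := mem_biUnion.1 this
          exact ⟨i, by rw [if_neg (mem_compl.1 hi)]; exact mem_union_left _ hvi⟩
        · have : v ∈ Iᶜ.biUnion C := by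
            rw [hCU]; exact mem_sdiff.2 ⟨mem_sdiff.2 ⟨hv, hvU⟩, hvM⟩
          obtain ⟨i, hi, hvi⟩ := mem_biUnion.1 this
          exact ⟨i, by rw [if_neg (mem_compl.1 hi)]; exact mem_union_right _ hvi⟩
  · intro i
    by_cases hi : i ∈ I
    · simpa only [if_pos hi] using (hA₀ i hi).2
    · simp only [if_neg hi]
      rw [card_union_of_disjoint (hBC i i hi hi), hBc i (mem_compl.2 hi),
        hCc i (mem_compl.2 hi)]
      have := hμ i hi
      omega
  · intro i hi
    simp [hi]
  · intro i hi
    simp only [hi, if_false]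
    have : (B i ∪ C i) ∩ M = B i := by
      ext v
      simp only [mem_inter, mem_union]
      constructor
      · rintro ⟨h | h, hM⟩
        · exact h
        · exact absurd hM (mem_sdiff.1 (hCM i hi h)).2
      · exact fun h => ⟨Or.inl h, (mem_sdiff.1 (hBM i hi h)).1⟩
    rw [this, hBc i (mem_compl.2 hi)]

end
-- Cores of edges.
section
open Finset

variable {α : Type*} [DecidableEq α]

/-- `M` is a core of the edge `E`: removing from `E` a nonempty set that does not meet `M` in
exactly one vertex leaves a robust set. -/
def IsCore (H : Finset (Finset α)) (K : ℕ) (E M : Finset α) : Prop :=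
  M ⊆ E ∧ ∀ A ⊆ E, A.Nonempty → (A ∩ M).card ≠ 1 → Robust H K (E \ A)

/-- Turns the search for a Δ-system into arithmetic: once the parts in `I` are realised by given
edges, it suffices to distribute the remaining core vertices over the other parts with no part
receiving exactly one. -/
theorem IsCore.not_vecFree {H : Finset (Finset α)} {k d p : ℕ} {a : Fin p → ℕ}
    (hH : ∀ F ∈ H, F.card = k) (ha : ∀ i, 0 < a i) (hak : ∑ i, a i = k) (hd : p ≤ d)
    {E M : Finset α} (hE : E ∈ H) (hM : IsCore H (k * (d + 1)) E M)
    {I : Finset (Fin p)} (hI : ∃ i, i ∉ I) (A₀ G : Fin p → Finset α)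
    (hA₀ : ∀ i ∈ I, A₀ i ⊆ E ∧ (A₀ i).card = a i)
    (hA₀d : ∀ i ∈ I, ∀ j ∈ I, i ≠ j → Disjoint (A₀ i) (A₀ j))
    (hG : ∀ i ∈ I, G i ∈ H ∧ G i ∩ E = E \ A₀ i)
    (hGd : ∀ i ∈ I, ∀ j ∈ I, i ≠ j → Disjoint (G i \ E) (G j \ E)) (μ : Fin p → ℕ)
    (hμ : ∀ i, i ∉ I → μ i ≤ a i ∧ μ i ≠ 1)
    (hμs : ∑ i ∈ Iᶜ, μ i = (M \ I.biUnion A₀).card) : ¬ VecFree a d H := by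
  obtain ⟨A, hA, hAI, hAμ⟩ := exists_vecPartition_extension hM.1 (hak.trans (hH E hE).symm) I A₀
    hA₀ hA₀d μ (fun i hi => (hμ i hi).1) hμs
  refine exists_vecNumDeltaSystem hH ha hd hE hA hI G (fun i hi => ?_) hGd (fun i hi => ?_)
  · rw [hAI i hi]; exact hG i hi
  · refine hM.2 _ ?_ ?_ ?_
    · rw [← hA.2.1]; exact subset_biUnion_of_mem A (mem_univ i)
    · rw [← card_pos, hA.2.2 i]; exact ha i
    · rw [hAμ i hi]; exact (hμ i hi).2

/-- An edge with core `{x}` is not met in `k - a i` vertices by an edge avoiding `x`. -/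
theorem IsCore.not_vecFree_of_singleton {H : Finset (Finset α)} {k d p : ℕ} {a : Fin p → ℕ}
    (hp : 2 ≤ p) (hH : ∀ F ∈ H, F.card = k) (ha : ∀ i, 0 < a i) (hak : ∑ i, a i = k) (hd : p ≤ d)
    {E : Finset α} {x : α} (hE : E ∈ H) (hM : IsCore H (k * (d + 1)) E {x}) {F : Finset α}
    (hF : F ∈ H) (hx : x ∉ F) {i : Fin p} (hi : (E ∩ F).card = k - a i) : ¬ VecFree a d H := by
  have hai : a i ≤ k := hak ▸ single_le_sum (f := a) (fun _ _ => Nat.zero_le _) (mem_univ i)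
  have hxE : x ∈ E := hM.1 (mem_singleton_self x)
  have hcard : (E \ F).card = a i := by
    have := card_sdiff_add_card_inter E F
    rw [hH E hE] at this
    omega
  have hother : ∃ j, j ∉ ({i} : Finset (Fin p)) := by
    by_contra! h
    have h1 := h ⟨0, by omega⟩
    have h2 := h ⟨1, by omega⟩
    rw [mem_singleton] at h1 h2
    rw [← h2] at h1
    simp at h1
  refine hM.not_vecFree hH ha hak hd hE (I := {i}) hother (fun _ => E \ F) (fun _ => F) ?_ ?_ ?_ ?_
    (fun _ => 0) (by simp) ?_
  · intro j hj
    rw [mem_singleton] at hj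
    subst hj
    exact ⟨sdiff_subset, hcard⟩
  · intro j hj j' hj' h
    rw [mem_singleton] at hj hj'
    exact absurd (hj.trans hj'.symm) h
  · intro j _
    exact ⟨hF, by rw [sdiff_sdiff_right_self, inf_eq_inter, inter_comm]⟩
  · intro j hj j' hj' h
    rw [mem_singleton] at hj hj'
    exact absurd (hj.trans hj'.symm) h
  · rw [singleton_biUnion, sdiff_eq_empty_iff_subset.2 (by simp [hxE, hx])]
    simp

/-- All but `O(n ^ (k - 2))` edges of a `k`-uniform hypergraph have a core. -/
theorem exists_core_of_forall_not_mem [Fintype α] (H : Finset (Finset α)) {k : ℕ}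
    (hH : ∀ F ∈ H, F.card = k) (K : ℕ) :
    ∃ X : Finset (Finset α),
      X.card ≤ (Fintype.card α).choose (k - 2) * (2 ^ (k - 2) * (K * K) + K * K) ∧
      ∀ E ∈ H, E ∉ X → ∃ M, IsCore H K E M := by
  classical
  have hZ : ∀ Q : Finset α, ∃ Z : Finset α, Z.card ≤ K ∧ Disjoint Z Q ∧
      (¬ Robust H K Q → ∀ F ∈ H, Q ⊆ F → ¬ Disjoint F Z) := by
    intro Q
    by_cases h : Robust H K Q
    · exact ⟨∅, by simp, by simp, fun h' => absurd h h'⟩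
    · have h' := h
      unfold Robust at h'
      push Not at h'
      obtain ⟨Z, h1, h2, h3⟩ := h'
      exact ⟨Z, h1, h2, fun _ => h3⟩
  choose Z hZc hZd hZ using hZ
  -- Exceptional edges have two vertices picked from blocking sets: both from the blocker of one `B
  -- ⊆ D`, or `u` from that of `D` and then `v` from that of `insert u D`. Given `D`, there are
  -- boundedly many.
  refine ⟨(powersetCard (k - 2) univ).biUnion fun D =>
    (D.powerset.biUnion fun B => (Z B ×ˢ Z B).image fun z => insert z.1 (insert z.2 D)) ∪
      ((Z D).biUnion fun u => (Z (insert u D)).image fun v => insert u (insert v D)), ?_, ?_⟩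
  · refine (card_biUnion_le_card_mul _ _ (2 ^ (k - 2) * (K * K) + K * K) fun D hD => ?_).trans ?_
    · refine (card_union_le _ _).trans (add_le_add ?_ ?_)
      · rw [← (mem_powersetCard.1 hD).2, ← card_powerset]
        refine card_biUnion_le_card_mul _ _ _ fun B _ => card_image_le.trans ?_
        rw [card_product]
        exact Nat.mul_le_mul (hZc B) (hZc B)
      · refine (card_biUnion_le_card_mul _ _ K fun u _ => card_image_le.trans (hZc _)).trans ?_
        exact Nat.mul_le_mul_right _ (hZc D)
    · rw [card_powersetCard, card_univ]
  · intro E hE hEX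
    simp only [mem_biUnion, mem_union, mem_powersetCard, mem_powerset, mem_image, mem_product,
      not_exists, not_and, Prod.exists, not_or, subset_univ, true_and] at hEX
    have hDcard : ∀ u ∈ E, ∀ v ∈ E, u ≠ v → (E \ {u, v}).card = k - 2 := by
      intro u hu v hv huv
      rw [card_sdiff_of_subset (by simp [insert_subset_iff, hu, hv]), hH E hE, card_pair huv]
    have hDE : ∀ u ∈ E, ∀ v ∈ E, insert u (insert v (E \ {u, v})) = E := by
      intro u hu v hv
      ext w
      simp only [mem_insert, mem_sdiff, mem_singleton, not_or]
      constructor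
      · rintro (rfl | rfl | h)
        exacts [hu, hv, h.1]
      · intro h
        tauto
    have hmeet : ∀ Q B : Finset α, Robust H K Q → B ⊆ Q → ¬ Robust H K B → ∃ z ∈ Z B, z ∈ Q := by
      intro Q B hQ hBQ hB
      by_contra! h
      obtain ⟨F, hF, h1, h2⟩ := hQ (Z B) (hZc B) (disjoint_left.2 h)
      exact hZ B hB F hF (hBQ.trans h1) h2
    -- Robust subsets of `E` are closed under intersection: a blocker of `Q ∩ Q'` would have to meet
    -- both `Q` and `Q'`, in different vertices, making `E` exceptional of the first kind.
    have hinter : ∀ Q Q', Q ⊆ E → Q' ⊆ E → Robust H K Q → Robust H K Q' →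
        Robust H K (Q ∩ Q') := by
      intro Q Q' hQE hQE' hQ hQ'
      by_contra hB
      obtain ⟨z, hz, hzQ⟩ := hmeet Q _ hQ inter_subset_left hB
      obtain ⟨z', hz', hzQ'⟩ := hmeet Q' _ hQ' inter_subset_right hB
      have hne : z ≠ z' := by
        rintro rfl
        exact disjoint_left.1 (hZd _) hz (mem_inter.2 ⟨hzQ, hzQ'⟩)
      refine (hEX _ (hDcard z (hQE hzQ) z' (hQE' hzQ') hne)).1 (Q ∩ Q') ?_ z z' ⟨hz, hz'⟩
        (hDE z (hQE hzQ) z' (hQE' hzQ'))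
      intro w hw
      refine mem_sdiff.2 ⟨hQE (mem_inter.1 hw).1, ?_⟩
      intro h
      rw [mem_insert, mem_singleton] at h
      rcases h with rfl | rfl
      · exact disjoint_left.1 (hZd _) hz hw
      · exact disjoint_left.1 (hZd _) hz' hw
    have hpairaux : ∀ u ∈ E, ∀ v ∈ E, u ≠ v → u ∈ Z (E \ {u, v}) → ¬ Robust H K (E.erase v) →
        False := by
      intro u hu v hv huv huZ hnr
      have h1 : insert u (E \ {u, v}) = E.erase v := by
        ext w
        simp only [mem_insert, mem_sdiff, mem_singleton, not_or, mem_erase]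
        constructor
        · rintro (rfl | h)
          · exact ⟨huv, hu⟩
          · exact ⟨h.2.2, h.1⟩
        · intro h
          tauto
      refine (hEX _ (hDcard u hu v hv huv)).2 u huZ v ?_ (hDE u hu v hv)
      rw [h1]
      have := hZ _ hnr E hE (erase_subset _ _)
      rw [not_disjoint_iff] at this
      obtain ⟨w, hw, hwZ⟩ := this
      by_cases hwv : w = v
      · rwa [← hwv] at hwZ ⊢
      · exact absurd (mem_erase.2 ⟨hwv, hw⟩) (disjoint_left.1 (hZd _) hwZ)
    set M := E.filter fun u => ¬ Robust H K (E.erase u) with hMdef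
    -- `E` is itself an edge, so a blocker of `E \ {u, v}` contains `u` or `v`; a blocker of the
    -- next larger set then contains the other vertex, and `E` is exceptional of the second kind.
    have hpair : ∀ u ∈ M, ∀ v ∈ M, u ≠ v → Robust H K (E \ {u, v}) := by
      intro u hu v hv huv
      rw [hMdef, mem_filter] at hu hv
      by_contra hnr
      have := hZ _ hnr E hE sdiff_subset
      rw [not_disjoint_iff] at this
      obtain ⟨w, hw, hwZ⟩ := this
      by_cases hwu : w = u
      · subst hwu
        exact hpairaux w hw v hv.1 huv hwZ hv.2
      · by_cases hwv : w = v
        · subst hwv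
          rw [pair_comm] at hwZ
          exact hpairaux w hw u hu.1 huv.symm hwZ hu.2
        · exact disjoint_left.1 (hZd _) hwZ (mem_sdiff.2 ⟨hw, by simp [hwu, hwv]⟩)
    have hunion : ∀ (T : Finset α) (P : α → Finset α), T.Nonempty →
        (∀ t ∈ T, Robust H K (E \ P t)) → Robust H K (E \ T.biUnion P) := by
      intro T P hT
      induction hT using Nonempty.cons_induction with
      | singleton t => intro h; simpa using h t (by simp)
      | cons t T ht hT ih =>
        intro h
        rw [cons_eq_insert, biUnion_insert, sdiff_union_distrib]
        exact hinter _ _ sdiff_subset sdiff_subset (h t (by simp))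
          (ih fun s hs => h s (by simp [hs]))
    refine ⟨M, filter_subset _ _, fun A hAE hA hAM => ?_⟩
    -- `A` is a union of singletons outside `M` and pairs inside `M`, so `E \ A` is an intersection
    -- of robust sets.
    have hP : ∀ u, ∃ P : Finset α, u ∈ A → u ∈ P ∧ P ⊆ A ∧ Robust H K (E \ P) := by
      intro u
      by_cases hu : u ∈ A
      · by_cases huM : u ∈ M
        · have : ∃ v ∈ A ∩ M, v ≠ u := by
            apply exists_mem_ne
            have : 0 < (A ∩ M).card := card_pos.2 ⟨u, mem_inter.2 ⟨hu, huM⟩⟩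
            omega
          obtain ⟨v, hv, hvu⟩ := this
          rw [mem_inter] at hv
          exact ⟨{u, v}, fun _ => ⟨by simp, by simp [insert_subset_iff, hu, hv.1],
            hpair u huM v hv.2 hvu.symm⟩⟩
        · refine ⟨{u}, fun _ => ⟨by simp, by simpa using hu, ?_⟩⟩
          rw [hMdef, mem_filter, not_and, not_not] at huM
          rw [sdiff_singleton_eq_erase]
          exact huM (hAE hu)
      · exact ⟨∅, fun h => absurd h hu⟩
    choose P hP using hP
    have : A.biUnion P = A := by
      ext w
      rw [mem_biUnion]
      exact ⟨fun ⟨u, hu, hw⟩ => (hP u hu).2.1 hw, fun hw => ⟨w, hw, (hP w hw).1⟩⟩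
    rw [← this]
    exact hunion A P hA fun t ht => (hP t ht).2.2

end
-- Distributing core vertices over the parts; partial transversals.
section
open Finset

theorem sum_update_add {ι : Type*} [DecidableEq ι] (s : Finset ι) (μ : ι → ℕ) {i : ι} (hi : i ∈ s)
    (c : ℕ) : ∑ j ∈ s, Function.update μ i c j + μ i = ∑ j ∈ s, μ j + c := by
  rw [sum_update_of_mem hi, ← add_sum_erase s μ hi, sdiff_singleton_eq_erase]
  ring

/-- Unless all `a i` equal `2`, a number `m ≥ 2` splits into `μ i ≤ a i` so that `μ i = 1` happens
only for `a i = 1`, and some `μ i` is at least `2`. -/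
theorem exists_multiplicities {ι : Type*} [Fintype ι] [DecidableEq ι] {a : ι → ℕ}
    (ha : ∀ i, 0 < a i) (h2 : ∃ i, 2 ≤ a i) (hn : ∃ i, a i ≠ 2) {m : ℕ} (hm : 2 ≤ m)
    (hms : m ≤ ∑ i, a i) :
    ∃ μ : ι → ℕ, (∀ i, μ i ≤ a i) ∧ ∑ i, μ i = m ∧ (∀ i, μ i = 1 → a i = 1) ∧ ∃ i, 2 ≤ μ i := by
  induction m, hm using Nat.le_induction with
  | base =>
    obtain ⟨i, hi⟩ := h2
    refine ⟨Function.update (fun _ => 0) i 2, fun j => ?_, ?_, fun j => ?_, i, by simp⟩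
    · rcases eq_or_ne j i with rfl | h <;> simp [*]
    · simp [sum_update_of_mem]
    · rcases eq_or_ne j i with rfl | h <;> simp [*]
  | succ m hm ih =>
    obtain ⟨μ, hμ, hμs, hμ1, i₀, hi₀⟩ := ih (by omega)
    have hone : ∀ i c, c ≤ a i → c = μ i + 1 → 2 ≤ c ∨ a i = 1 →
        ∃ μ : ι → ℕ, (∀ i, μ i ≤ a i) ∧ ∑ i, μ i = m + 1 ∧ (∀ i, μ i = 1 → a i = 1) ∧
          ∃ i, 2 ≤ μ i := by
      intro i c hc hcμ hc2
      refine ⟨Function.update μ i c, fun j => ?_, ?_, fun j => ?_, i₀, ?_⟩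
      · rcases eq_or_ne j i with rfl | h
        · simpa using hc
        · simp [*]
      · have := sum_update_add univ μ (mem_univ i) c
        omega
      · rcases eq_or_ne j i with rfl | h
        · simp; omega
        · simpa [h] using hμ1 j
      · rcases eq_or_ne i₀ i with rfl | h
        · simp; omega
        · simpa [h] using hi₀
    have htwo : ∀ i j c e, i ≠ j → c ≤ a i → e ≤ a j → c + e = μ i + μ j + 1 → 2 ≤ e → c ≠ 1 →
        ∃ μ : ι → ℕ, (∀ i, μ i ≤ a i) ∧ ∑ i, μ i = m + 1 ∧ (∀ i, μ i = 1 → a i = 1) ∧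
          ∃ i, 2 ≤ μ i := by
      intro i j c e hij hc he hce he2 hc1
      refine ⟨Function.update (Function.update μ i c) j e, fun l => ?_, ?_, fun l => ?_, j, ?_⟩
      · rcases eq_or_ne l j with rfl | h
        · simpa
        · rcases eq_or_ne l i with rfl | h' <;> simp [*]
      · have h1 := sum_update_add univ μ (mem_univ i) c
        have h2 := sum_update_add univ (Function.update μ i c) (mem_univ j) e
        rw [Function.update_of_ne hij.symm] at h2
        omega
      · rcases eq_or_ne l j with rfl | h
        · simp; omega
        · rcases eq_or_ne l i with rfl | h'
          · simp [h]; omega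
          · simpa [h, h'] using hμ1 l
      · simpa
    -- Increase one value by 1 if possible. Otherwise every part is empty or full, and an empty part
    -- `i` of size at least 2 receives 2 by taking 1 from another part.
    by_cases c1 : ∃ i, a i = 1 ∧ μ i = 0
    · obtain ⟨i, h1, h2⟩ := c1
      exact hone i 1 (by omega) (by omega) (Or.inr h1)
    by_cases c2 : ∃ i, 2 ≤ μ i ∧ μ i < a i
    · obtain ⟨i, h1, h2⟩ := c2
      exact hone i (μ i + 1) (by omega) rfl (Or.inl (by omega))
    push Not at c1 c2
    obtain ⟨i, -, hi⟩ : ∃ i ∈ univ, μ i < a i := exists_lt_of_sum_lt (by omega)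
    have hi0 : μ i = 0 := by
      have h1 := hμ1 i
      have h2 := c2 i
      omega
    have hai : 2 ≤ a i := by
      have h1 := c1 i
      have h2 := ha i
      omega
    by_cases c3 : ∃ j, μ j = 1
    · obtain ⟨j, hj⟩ := c3
      exact htwo j i 0 2 (by rintro rfl; omega) (by omega) hai (by omega) le_rfl (by omega)
    by_cases c4 : ∃ j, 3 ≤ μ j
    · obtain ⟨j, hj⟩ := c4
      have := hμ j
      exact htwo j i (μ j - 1) 2 (by rintro rfl; omega) (by omega) hai (by omega) le_rfl (by omega)
    -- All values are now 0 or 2. A part `j` with `a j ≠ 2` must be empty and of size at least 3, so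
    -- the 2 at `i₀` is replaced by a 3 at `j`.
    push Not at c3 c4
    obtain ⟨j, hj⟩ := hn
    have h1 := c1 j
    have h2 := c2 j
    have h3 := c3 j
    have h4 := c4 j
    have h5 := hμ j
    have h6 := ha j
    have h7 := c4 i₀
    exact htwo i₀ j 0 3 (by rintro rfl; omega) (by omega) (by omega) (by omega) (by omega)
      (by omega)

theorem exists_zero_two_of_even {ι : Type*} [DecidableEq ι] (J : Finset ι) {e : ℕ} (he : Even e)
    (heJ : e ≤ 2 * J.card) : ∃ μ : ι → ℕ, (∀ i, μ i = 0 ∨ μ i = 2) ∧ ∑ i ∈ J, μ i = e := by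
  obtain ⟨c, hc⟩ := he
  obtain ⟨T, hT, hTc⟩ := exists_subset_card_eq (s := J) (n := c) (by omega)
  refine ⟨fun i => if i ∈ T then 2 else 0, fun i => ?_, ?_⟩
  · by_cases h : i ∈ T <;> simp [h]
  · rw [← sum_filter, filter_mem_eq_inter, inter_eq_right.2 hT, sum_const, hTc, hc]
    simp; ring

/-- If the sets `N x` are large on average, `t` indices have distinct representatives. -/
theorem exists_partial_transversal {α : Type*} [DecidableEq α] {k t : ℕ} (M : Finset α)
    (N : α → Finset α) (hMk : M.card ≤ k) (ht : t + 2 ≤ M.card)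
    (hsum : ∑ x ∈ M, (1 : ℚ) / ((N x).card + 1) < 1 + 2 / k) :
    ∃ (X : Finset α) (y : α → α), X ⊆ M ∧ X.card = t ∧ (∀ x ∈ X, y x ∈ N x) ∧
      ∀ x ∈ X, ∀ x' ∈ X, x ≠ x' → y x ≠ y x' := by
  -- Hall's theorem with deficiency: `D` dummy representatives are available to everyone, and at
  -- most `D` elements end up using them.
  set D : ℕ := M.card - t with hD
  let N' : M → Finset (α ⊕ Fin D) := fun x => (N x).disjSum univ
  have hall : ∀ s : Finset M, s.card ≤ (s.biUnion N').card := by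
    intro s
    rcases s.eq_empty_or_nonempty with rfl | hs
    · simp
    have hU : s.biUnion N' = (s.biUnion fun x => N x).disjSum univ := by
      obtain ⟨x₀, hx₀⟩ := hs
      ext z
      rcases z with z | z
      · simp [N']
      · simp only [N', mem_biUnion, inr_mem_disjSum, mem_univ, and_true, iff_true]
        exact ⟨x₀, hx₀⟩
    rw [hU, card_disjSum, card_univ, Fintype.card_fin]
    by_contra! hlt
    set Y := (s.biUnion fun x : M => N x).card with hY
    have hsM : s.card ≤ M.card := by simpa using card_le_univ s
    have h1 : ∑ x ∈ s, (1 : ℚ) / ((N (x : α)).card + 1) ≤ ∑ x ∈ M, (1 : ℚ) / ((N x).card + 1) := by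
      rw [← sum_coe_sort M]
      exact sum_le_sum_of_subset_of_nonneg (subset_univ _) fun _ _ _ => by positivity
    have h2 : (s.card : ℚ) * (1 / (Y + 1)) ≤ ∑ x ∈ s, (1 : ℚ) / ((N (x : α)).card + 1) := by
      rw [← nsmul_eq_mul]
      refine card_nsmul_le_sum _ _ _ fun x hx => ?_
      have : (N (x : α)).card ≤ Y := card_le_card (subset_biUnion_of_mem (fun x : M => N x) hx)
      gcongr
    have hYk : Y + 1 ≤ k := by omega
    have h3 : (1 : ℚ) + 2 / k ≤ s.card * (1 / (Y + 1)) := by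
      -- A violation of Hall's condition exceeds `Y + D`, and `D ≥ 2` by `ht`.
      have h4 : ((Y : ℚ) + 3) ≤ s.card := by
        have : Y + 3 ≤ s.card := by omega
        exact_mod_cast this
      have h5 : (2 : ℚ) / k ≤ 2 / (Y + 1) := by
        gcongr
        exact_mod_cast hYk
      calc (1 : ℚ) + 2 / k ≤ 1 + 2 / (Y + 1) := by gcongr
        _ = (Y + 3) * (1 / (Y + 1)) := by field_simp; ring
        _ ≤ _ := by gcongr
    linarith
  obtain ⟨f, hf, hfN⟩ := (all_card_le_biUnion_card_iff_exists_injective N').1 hall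
  let X₀ : Finset M := univ.filter fun x => (f x).isLeft
  have hX₀ : t ≤ X₀.card := by
    have h1 : (univ.filter fun x => ¬ (f x).isLeft = true).card ≤ D := by
      have : (univ.filter fun x => ¬ (f x).isLeft = true).image f ⊆
          (univ : Finset (Fin D)).map ⟨Sum.inr, Sum.inr_injective⟩ := by
        intro z hz
        rw [mem_image] at hz
        obtain ⟨x, hx, rfl⟩ := hz
        rw [mem_filter] at hx
        cases h : f x with
        | inl v => simp [h] at hx
        | inr v => simp
      have h := card_le_card this
      rw [card_image_of_injective _ hf] at h
      simpa using h
    have h2 := card_filter_add_card_filter_not (s := (univ : Finset M)) (fun x => (f x).isLeft = true)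
    rw [card_univ, Fintype.card_coe] at h2
    simp only [X₀]
    omega
  obtain ⟨X₁, hX₁, hX₁c⟩ := exists_subset_card_eq hX₀
  let y : α → α := fun x => if h : x ∈ M then (f ⟨x, h⟩).elim id (fun _ => x) else x
  have hy : ∀ x : M, x ∈ X₁ → f x = Sum.inl (y x) := by
    intro x hx
    have h1 := hX₁ hx
    simp only [X₀, mem_filter, mem_univ, true_and] at h1
    simp only [y, x.2, dif_pos]
    cases h : f x with
    | inl v => simp
    | inr v => simp [h] at h1
  refine ⟨X₁.map ⟨Subtype.val, Subtype.val_injective⟩, y, ?_, by simpa using hX₁c, ?_, ?_⟩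
  · intro x hx
    simp only [mem_map, Function.Embedding.coeFn_mk] at hx
    obtain ⟨x, -, rfl⟩ := hx
    exact x.2
  · intro x hx
    simp only [mem_map, Function.Embedding.coeFn_mk] at hx
    obtain ⟨x, hx, rfl⟩ := hx
    have := hfN x
    rw [hy x hx] at this
    simpa [N'] using this
  · intro x hx x' hx' hne h
    simp only [mem_map, Function.Embedding.coeFn_mk] at hx hx'
    obtain ⟨x, hx, rfl⟩ := hx
    obtain ⟨x', hx', rfl⟩ := hx'
    apply hne
    congr 1
    apply hf
    rw [hy x hx, hy x' hx', h]

end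
-- Which cores and exchanges a Δ-system-free hypergraph allows.
section
open Finset

variable {α : Type*} [DecidableEq α] {H : Finset (Finset α)} {k d p : ℕ} {a : Fin p → ℕ}
  {E E' M M' : Finset α} {x y z : α}

theorem IsCore.nonempty (hp : 2 ≤ p) (hH : ∀ F ∈ H, F.card = k) (ha : ∀ i, 0 < a i)
    (hak : ∑ i, a i = k) (hd : p ≤ d) (hfree : VecFree a d H) (hE : E ∈ H)
    (hM : IsCore H (k * (d + 1)) E M) : M.Nonempty := by
  rw [nonempty_iff_ne_empty]
  rintro rfl
  exact hM.not_vecFree hH ha hak hd hE (I := ∅) ⟨⟨0, by omega⟩, by simp⟩ (fun _ => ∅) (fun _ => ∅)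
    (by simp) (by simp) (by simp) (by simp) (fun _ => 0) (by simp) (by simp) hfree

theorem IsCore.card_le_one (hH : ∀ F ∈ H, F.card = k) (ha : ∀ i, 0 < a i)
    (hak : ∑ i, a i = k) (hd : p ≤ d) (hfree : VecFree a d H) (hE : E ∈ H)
    (hM : IsCore H (k * (d + 1)) E M) (h2 : ∃ i, 2 ≤ a i) (hn : ∃ i, a i ≠ 2)
    (h1 : ∀ i, a i ≠ 1) : M.card ≤ 1 := by
  by_contra! hcard
  obtain ⟨μ, hμ, hμs, hμ1, i, -⟩ := exists_multiplicities ha h2 hn hcard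
    (by rw [hak, ← hH E hE]; exact card_le_card hM.1)
  exact hM.not_vecFree hH ha hak hd hE (I := ∅) ⟨i, by simp⟩ (fun _ => ∅) (fun _ => ∅)
    (by simp) (by simp) (by simp) (by simp) μ (fun i _ => ⟨hμ i, fun h => h1 i (hμ1 i h)⟩)
    (by simpa using hμs) hfree

/-- When all parts have size 2, a core of even size can be split into whole parts, leaving the other
parts free of core vertices. -/
theorem IsCore.odd_card (hp : 2 ≤ p) (hH : ∀ F ∈ H, F.card = k) (ha2 : ∀ i, a i = 2)
    (hak : ∑ i, a i = k) (hd : p ≤ d) (hfree : VecFree a d H) (hE : E ∈ H)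
    (hM : IsCore H (k * (d + 1)) E M) : Odd M.card := by
  rw [← Nat.not_even_iff_odd]
  intro he
  obtain ⟨μ, hμ, hμs⟩ := exists_zero_two_of_even (univ : Finset (Fin p)) he (by
    have := card_le_card hM.1
    rw [hH E hE, ← hak] at this
    simp [ha2] at this ⊢
    omega)
  exact hM.not_vecFree hH (by simp [ha2]) hak hd hE (I := ∅) ⟨⟨0, by omega⟩, by simp⟩ (fun _ => ∅)
    (fun _ => ∅) (by simp) (by simp) (by simp) (by simp) μ
    (fun i _ => by rcases hμ i with h | h <;> simp [h, ha2]) (by simpa using hμs) hfree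

/-- The edge `F` realises the part `{x, z}`, which uses up one core vertex; the even remainder of
the core fills whole parts of size 2. -/
theorem IsCore.not_vecFree_of_pair (hp : 2 ≤ p) (hH : ∀ F ∈ H, F.card = k) (ha2 : ∀ i, a i = 2)
    (hak : ∑ i, a i = k) (hd : p ≤ d) (hE : E ∈ H) (hM : IsCore H (k * (d + 1)) E M)
    (hx : x ∈ M) (hz : z ∈ E) (hzM : z ∉ M) {F : Finset α} (hF : F ∈ H)
    (hFE : F ∩ E = E \ {x, z}) : ¬ VecFree a d H := by
  intro hfree
  have hxE := hM.1 hx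
  have hxz : x ≠ z := fun h => hzM (h ▸ hx)
  have hodd := hM.odd_card hp hH ha2 hak hd hfree hE
  have hMx : M \ {x, z} = M.erase x := by
    ext w
    simp only [mem_sdiff, mem_insert, mem_singleton, not_or, mem_erase]
    constructor
    · exact fun h => ⟨h.2.1, h.1⟩
    · exact fun h => ⟨h.2, h.1, fun h' => hzM (h' ▸ h.2)⟩
  have hcard : (M.erase x).card = M.card - 1 := card_erase_of_mem hx
  have hME : M.card < E.card := card_lt_card ⟨hM.1, fun h => hzM (h hz)⟩
  set i : Fin p := ⟨0, by omega⟩ with hi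
  obtain ⟨μ, hμ, hμs⟩ := exists_zero_two_of_even ({i}ᶜ : Finset (Fin p)) (e := M.card - 1)
    (by obtain ⟨c, hc⟩ := hodd; exact ⟨c, by omega⟩) (by
      rw [card_compl, card_singleton, Fintype.card_fin]
      rw [hH E hE, ← hak] at hME
      simp [ha2] at hME
      omega)
  refine hM.not_vecFree hH (by simp [ha2]) hak hd hE (I := {i}) ⟨⟨1, by omega⟩, by simp [hi]⟩
    (fun _ => {x, z}) (fun _ => F) ?_ ?_ ?_ ?_ μ
    (fun j _ => by rcases hμ j with h | h <;> simp [h, ha2]) ?_ hfree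
  · intro j _
    exact ⟨by simp [insert_subset_iff, hxE, hz], by rw [card_pair hxz, ha2]⟩
  · intro j hj j' hj' h
    rw [mem_singleton] at hj hj'
    exact absurd (hj.trans hj'.symm) h
  · exact fun _ _ => ⟨hF, hFE⟩
  · intro j hj j' hj' h
    rw [mem_singleton] at hj hj'
    exact absurd (hj.trans hj'.symm) h
  · rw [hμs, singleton_biUnion, hMx, hcard]

/-- Robustness lets us choose an edge through `E \ A` avoiding `A` and a further vertex. -/
theorem Robust.exists_avoiding {K : ℕ} {A : Finset α} {y : α} (h : Robust H K (E \ A))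
    (hA : A.card + 1 ≤ K) (hy : y ∉ E \ A) :
    ∃ F ∈ H, E \ A ⊆ F ∧ Disjoint F A ∧ y ∉ F := by
  obtain ⟨F, hF, h1, h2⟩ := h (insert y A) ((card_insert_le _ _).trans hA) (by
    rw [disjoint_insert_left]
    exact ⟨hy, disjoint_sdiff⟩)
  rw [disjoint_insert_right] at h2
  exact ⟨F, hF, h1, h2.2, h2.1⟩

/-- Since `k` is even and cores are odd, `E` has a vertex `z` outside `M`. Wherever `z` and `y` lie
relative to `M'`, one of the two cores supplies an edge meeting the other host in all but one core
and one non-core vertex. -/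
theorem IsCore.not_vecFree_of_forall_eq_two (hp : 2 ≤ p) (hH : ∀ F ∈ H, F.card = k)
    (ha2 : ∀ i, a i = 2) (hak : ∑ i, a i = k) (hd : p ≤ d) (hE : E ∈ H)
    (hM : IsCore H (k * (d + 1)) E M) (hx : x ∈ M) (hy : y ∉ E)
    (hE' : insert y (E.erase x) ∈ H)
    (hM' : IsCore H (k * (d + 1)) (insert y (E.erase x)) M') : ¬ VecFree a d H := by
  intro hfree
  have hxE := hM.1 hx
  have hodd := hM.odd_card hp hH ha2 hak hd hfree hE
  have hodd' := hM'.odd_card hp hH ha2 hak hd hfree hE'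
  have hk : k = 2 * p := by rw [← hak]; simp [ha2, mul_comm]
  have hK : 4 ≤ k * (d + 1) := by nlinarith
  obtain ⟨z, hz, hzM⟩ : ∃ z ∈ E, z ∉ M := by
    by_contra! h
    have : M = E := hM.1.antisymm h
    rw [this, hH E hE, hk] at hodd
    exact Nat.not_odd_iff_even.2 (even_two_mul p) hodd
  have hxz : x ≠ z := fun h => hzM (h ▸ hx)
  have hyz : y ≠ z := fun h => hy (h ▸ hz)
  have hxy : x ≠ y := fun h => hy (h ▸ hxE)
  by_cases hzM' : z ∈ M'
  · by_cases hyM' : y ∈ M'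
    · have hpair : ({y, z} : Finset α) ∩ M' = {y, z} :=
        inter_eq_left.2 (by simp [insert_subset_iff, hzM', hyM'])
      obtain ⟨F, hF, h1, h2, h3⟩ := (hM'.2 {y, z} (by simp [insert_subset_iff, hz, hxz.symm])
        ⟨y, by simp⟩ (by rw [hpair, card_pair hyz]; simp)).exists_avoiding (y := x)
        (by rw [card_pair hyz]; omega) (by simp [hxy])
      refine hM.not_vecFree_of_pair hp hH ha2 hak hd hE hx hz hzM hF ?_ hfree
      ext w
      have h4 := mem_of_subset h1 (a := w)
      have h5 : w ∈ F → w ∉ _ := fun h => disjoint_left.1 h2 h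
      simp only [mem_sdiff, mem_insert, mem_singleton, mem_erase, mem_inter] at h4 h5 ⊢
      grind
    · obtain ⟨F, hF, h1, h2, h3⟩ := (hM.2 {z} (by simpa using hz) ⟨z, by simp⟩ (by
        simp [hzM])).exists_avoiding (y := y) (by rw [card_singleton]; omega) (by simp [hy])
      refine hM'.not_vecFree_of_pair hp hH ha2 hak hd hE' hzM' (z := y) (by simp) hyM' hF ?_ hfree
      have hxF : x ∈ F := h1 (by simp [hxE, hxz])
      ext w
      have h4 := mem_of_subset h1 (a := w)
      have h5 : w ∈ F → w ∉ _ := fun h => disjoint_left.1 h2 h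
      simp only [mem_sdiff, mem_insert, mem_singleton, mem_erase, mem_inter] at h4 h5 ⊢
      grind
  · obtain ⟨F, hF, h1, h2, h3⟩ := (hM'.2 {z} (by simp [hz, hxz.symm]) ⟨z, by simp⟩ (by
      simp [hzM'])).exists_avoiding (y := x) (by rw [card_singleton]; omega) (by simp [hxy])
    refine hM.not_vecFree_of_pair hp hH ha2 hak hd hE hx hz hzM hF ?_ hfree
    ext w
    have h4 := mem_of_subset h1 (a := w)
    have h5 : w ∈ F → w ∉ _ := fun h => disjoint_left.1 h2 h
    simp only [mem_sdiff, mem_insert, mem_singleton, mem_erase, mem_inter] at h4 h5 ⊢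
    grind

theorem part_lt (hp : 2 ≤ p) (ha : ∀ i, 0 < a i) (hak : ∑ i, a i = k) (i : Fin p) : a i < k := by
  obtain ⟨j, hj⟩ : ∃ j : Fin p, j ≠ i := by
    have : Nontrivial (Fin p) := Fin.nontrivial_iff_two_le.2 hp
    exact exists_ne i
  have := single_lt_sum hj (mem_univ i) (mem_univ j) (ha j) (fun _ _ _ => Nat.zero_le _)
  omega

theorem exists_two_le_part (hpk : p < k) (hak : ∑ i, a i = k) : ∃ i, 2 ≤ a i := by
  by_contra! h
  have : ∑ i, a i ≤ ∑ _i : Fin p, 1 := sum_le_sum fun i _ => by have := h i; omega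
  simp at this
  omega

/-- The core vertex of an edge with singleton core can't be exchanged within edges having cores. -/
theorem IsCore.not_vecFree_of_singleton_exchange (hp : 2 ≤ p) (hpk : p < k)
    (hH : ∀ F ∈ H, F.card = k) (ha : ∀ i, 0 < a i) (hak : ∑ i, a i = k) (hd : p ≤ d) (hE : E ∈ H)
    (hM : IsCore H (k * (d + 1)) E {x}) (hy : y ∉ E) (hE' : insert y (E.erase x) ∈ H)
    (hM' : IsCore H (k * (d + 1)) (insert y (E.erase x)) M') : ¬ VecFree a d H := by
  intro hfree
  have hxE : x ∈ E := hM.1 (mem_singleton_self x)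
  have hxy : x ≠ y := fun h => hy (h ▸ hxE)
  by_cases h1 : ∃ i, a i = 1
  · obtain ⟨i, hi⟩ := h1
    refine hM.not_vecFree_of_singleton hp hH ha hak hd hE hE' (by simp [hxy]) (i := i) ?_ hfree
    have : E ∩ insert y (E.erase x) = E.erase x := by
      ext w; simp only [mem_inter, mem_insert, mem_erase]; grind
    rw [this, card_erase_of_mem hxE, hH E hE, hi]
  push Not at h1
  by_cases h2 : ∀ i, a i = 2
  · exact hM.not_vecFree_of_forall_eq_two hp hH h2 hak hd hE (mem_singleton_self x) hy hE' hM' hfree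
  push Not at h2
  obtain ⟨i, hi⟩ := exists_two_le_part hpk hak
  have hik := part_lt hp ha hak i
  have hcard' : M'.card = 1 := le_antisymm
    (hM'.card_le_one hH ha hak hd hfree hE' ⟨i, hi⟩ h2 h1)
    (card_pos.2 (hM'.nonempty hp hH ha hak hd hfree hE'))
  obtain ⟨x', rfl⟩ := card_eq_one.1 hcard'
  -- `A` misses the core `{x'}` of the new edge, so some edge contains the rest of it and avoids `A`
  -- and `x`. That edge misses exactly `A ∪ {x}`, of size `a i`, from `E`.
  obtain ⟨A, hA, hAc⟩ := exists_subset_card_eq (s := (E.erase x).erase x') (n := a i - 1) (by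
    have h1 := pred_card_le_card_erase (s := E.erase x) (a := x')
    have h2 := pred_card_le_card_erase (s := E) (a := x)
    rw [hH E hE] at h2
    omega)
  have hAE : A ⊆ E.erase x := hA.trans (erase_subset _ _)
  have hAx' : A ∩ {x'} = ∅ := by
    rw [← disjoint_iff_inter_eq_empty, disjoint_singleton_right]
    exact fun h => (mem_erase.1 (hA h)).1 rfl
  obtain ⟨F, hF, h3, h4, h5⟩ := (hM'.2 A (hAE.trans (subset_insert _ _))
    (card_pos.1 (by omega)) (by simp [hAx'])).exists_avoiding (y := x)
    (by have := Nat.le_mul_of_pos_right k (Nat.succ_pos d); rw [Nat.succ_eq_add_one] at this; omega)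
    (by simp [hxy])
  refine hM.not_vecFree_of_singleton hp hH ha hak hd hE hF h5 (i := i) ?_ hfree
  have : E ∩ F = E.erase x \ A := by
    ext w
    have h6 := mem_of_subset h3 (a := w)
    have h7 : w ∈ F → w ∉ _ := fun h => disjoint_left.1 h4 h
    simp only [mem_sdiff, mem_insert, mem_erase, mem_inter] at h6 h7 ⊢
    grind
  rw [this, card_sdiff_of_subset hAE, card_erase_of_mem hxE, hH E hE, hAc]
  omega

/-- If some part has size one, then edges with a large core have large weight. -/
theorem IsCore.le_sum_of_exists_eq_one (hpk : p < k)
    (hH : ∀ F ∈ H, F.card = k) (ha : ∀ i, 0 < a i) (hak : ∑ i, a i = k) (hd : p ≤ d)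
    (hfree : VecFree a d H) (hE : E ∈ H) (hM : IsCore H (k * (d + 1)) E M) (hcard : 2 ≤ M.card)
    (h1 : ∃ i, a i = 1) (N : α → Finset α)
    (hN : ∀ x ∈ M, ∀ y ∈ N x, y ∉ E ∧ insert y (E.erase x) ∈ H) :
    1 + 2 / (k : ℚ) ≤ ∑ x ∈ M, (1 : ℚ) / ((N x).card + 1) := by
  by_contra! hlt
  have hMk : M.card ≤ k := hH E hE ▸ card_le_card hM.1
  obtain ⟨μ, hμ, hμs, hμ1, i₀, hi₀⟩ := exists_multiplicities ha (exists_two_le_part hpk hak)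
    (by obtain ⟨i, hi⟩ := h1; exact ⟨i, by omega⟩) hcard (by omega)
  -- Parts receiving one core vertex have size 1 and cannot rely on robustness; they are realised by
  -- exchanges `x ↦ y` with distinct `y`, which small weight would provide.
  set I : Finset (Fin p) := univ.filter fun i => μ i = 1 with hI
  have hμI : ∑ i ∈ I, μ i = I.card := by
    rw [sum_congr rfl fun i hi => (mem_filter.1 hi).2, card_eq_sum_ones]
  have hi₀I : i₀ ∈ Iᶜ := by simp [hI]; omega
  have hsplit : ∑ i ∈ I, μ i + ∑ i ∈ Iᶜ, μ i = M.card := by rw [sum_add_sum_compl, hμs]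
  have ht : I.card + 2 ≤ M.card := by
    have := single_le_sum (f := μ) (fun _ _ => Nat.zero_le _) hi₀I
    omega
  obtain ⟨X, y, hXM, hXc, hyN, hyd⟩ := exists_partial_transversal M N hMk ht hlt
  let e : I ≃ X := equivOfCardEq hXc.symm
  obtain ⟨x₀, -⟩ := card_pos.1 (by omega : 0 < M.card)
  let f : Fin p → α := fun i => if h : i ∈ I then (e ⟨i, h⟩ : α) else x₀
  have hfX : ∀ i ∈ I, f i ∈ X := by
    intro i hi
    simp only [f, hi, dif_pos]
    exact (e ⟨i, hi⟩).2
  have hfinj : ∀ i ∈ I, ∀ j ∈ I, i ≠ j → f i ≠ f j := by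
    intro i hi j hj hij h
    simp only [f, hi, hj, dif_pos] at h
    have := e.injective (Subtype.ext h)
    exact hij (by simpa using this)
  have hfE : ∀ i ∈ I, f i ∈ E := fun i hi => hM.1 (hXM (hfX i hi))
  have hyf : ∀ i ∈ I, y (f i) ∉ E ∧ insert (y (f i)) (E.erase (f i)) ∈ H := fun i hi =>
    hN _ (hXM (hfX i hi)) _ (hyN _ (hfX i hi))
  refine hM.not_vecFree hH ha hak hd hE (I := I) ⟨i₀, mem_compl.1 hi₀I⟩ (fun i => {f i})
    (fun i => insert (y (f i)) (E.erase (f i))) ?_ ?_ ?_ ?_ μ ?_ ?_ hfree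
  · intro i hi
    exact ⟨by simpa using hfE i hi, by rw [card_singleton, hμ1 i (mem_filter.1 hi).2]⟩
  · intro i hi j hj hij
    simpa using hfinj i hi j hj hij
  · intro i hi
    refine ⟨(hyf i hi).2, ?_⟩
    have := (hyf i hi).1
    ext w
    simp only [mem_inter, mem_insert, mem_erase, mem_sdiff, mem_singleton]
    grind
  · have hsub : ∀ i ∈ I, insert (y (f i)) (E.erase (f i)) \ E ⊆ {y (f i)} := by
      intro i hi w
      simp only [mem_sdiff, mem_insert, mem_erase, mem_singleton]
      tauto
    intro i hi j hj hij
    refine disjoint_of_subset_left (hsub i hi) (disjoint_of_subset_right (hsub j hj) ?_)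
    rw [disjoint_singleton]
    exact hyd _ (hfX i hi) _ (hfX j hj) (hfinj i hi j hj hij)
  · intro i hi
    exact ⟨hμ i, fun h => hi (by simp [hI, h])⟩
  · rw [biUnion_singleton, card_sdiff_of_subset, card_image_of_injOn]
    · omega
    · intro i hi j hj h
      by_contra hij
      exact hfinj i hi j hj hij h
    · intro w hw
      obtain ⟨i, hi, rfl⟩ := mem_image.1 hw
      exact hXM (hfX i hi)

end
-- The weight count.
section
open Finset

variable {α : Type*} [DecidableEq α] [Fintype α]

/-- The vertices that can replace `x` in the edge `E` of `G`. -/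
def exchanges (G : Finset (Finset α)) (E : Finset α) (x : α) : Finset α :=
  univ.filter fun y => y ∉ E ∧ insert y (E.erase x) ∈ G

/-- Each summand is at most the reciprocal of the degree of `E.erase x` in `G`. Regrouped by
(k-1)-sets, every set of degree δ contributes at most δ · (1/δ) = 1. -/
theorem sum_exchanges_le {G : Finset (Finset α)} {k : ℕ} (hG : ∀ E ∈ G, E.card = k) :
    ∑ E ∈ G, ∑ x ∈ E, (1 : ℚ) / ((exchanges G E x).card + 1) ≤
      (Fintype.card α).choose (k - 1) := by
  set g : Finset α → ℚ := fun T => 1 / ((G.filter fun F => T ⊆ F).card : ℚ) with hg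
  have hg0 : ∀ T, 0 ≤ g T := fun T => by positivity
  have hdeg : ∀ E ∈ G, ∀ x ∈ E, (1 : ℚ) / ((exchanges G E x).card + 1) ≤ g (E.erase x) := by
    intro E hE x hx
    have hpos : 0 < (G.filter fun F => E.erase x ⊆ F).card :=
      card_pos.2 ⟨E, mem_filter.2 ⟨hE, erase_subset _ _⟩⟩
    have hle : (G.filter fun F => E.erase x ⊆ F).card ≤ (exchanges G E x).card + 1 := by
      have hsub : (G.filter fun F => E.erase x ⊆ F) ⊆
          insert E ((exchanges G E x).image fun y => insert y (E.erase x)) := by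
        intro F hF
        rw [mem_filter] at hF
        obtain ⟨y, hy⟩ : ∃ y, F \ E.erase x = {y} := by
          rw [← card_eq_one, card_sdiff_of_subset hF.2, card_erase_of_mem hx, hG F hF.1, hG E hE]
          have := card_pos.2 ⟨x, hx⟩
          rw [hG E hE] at this
          omega
        have hFy : F = insert y (E.erase x) := by
          rw [← union_sdiff_of_subset hF.2, hy, union_comm, singleton_union]
        have hyF : y ∉ E.erase x := by
          have : y ∈ F \ E.erase x := by rw [hy]; simp
          exact (mem_sdiff.1 this).2
        rw [mem_insert, mem_image]
        by_cases hyx : y = x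
        · left; rw [hFy, hyx, insert_erase hx]
        · right
          refine ⟨y, ?_, hFy.symm⟩
          rw [exchanges, mem_filter]
          exact ⟨mem_univ _, fun h => hyF (mem_erase.2 ⟨hyx, h⟩), hFy ▸ hF.1⟩
      refine (card_le_card hsub).trans ((card_insert_le _ _).trans ?_)
      exact Nat.succ_le_succ card_image_le
    rw [hg]
    have h1 : (0 : ℚ) < (G.filter fun F => E.erase x ⊆ F).card := by exact_mod_cast hpos
    have h2 : ((G.filter fun F => E.erase x ⊆ F).card : ℚ) ≤ (exchanges G E x).card + 1 := by
      exact_mod_cast hle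
    exact one_div_le_one_div_of_le h1 h2
  calc ∑ E ∈ G, ∑ x ∈ E, (1 : ℚ) / ((exchanges G E x).card + 1)
      ≤ ∑ E ∈ G, ∑ x ∈ E, g (E.erase x) :=
        sum_le_sum fun E hE => sum_le_sum fun x hx => hdeg E hE x hx
    _ ≤ ∑ E ∈ G, ∑ T ∈ powersetCard (k - 1) E, g T := by
        refine sum_le_sum fun E hE => ?_
        rw [← sum_image (f := g) (g := fun x => E.erase x)]
        · refine sum_le_sum_of_subset_of_nonneg ?_ fun T _ _ => hg0 T
          intro T hT
          obtain ⟨x, hx, rfl⟩ := mem_image.1 hT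
          exact mem_powersetCard.2 ⟨erase_subset _ _, by rw [card_erase_of_mem hx, hG E hE]⟩
        · exact erase_injOn E
    _ = ∑ T ∈ powersetCard (k - 1) univ, ∑ E ∈ G.filter (fun F => T ⊆ F), g T := by
        refine sum_comm' fun E T => ?_
        simp only [mem_powersetCard, mem_filter, subset_univ, true_and]
        tauto
    _ ≤ ∑ T ∈ powersetCard (k - 1) (univ : Finset α), 1 := by
        refine sum_le_sum fun T _ => ?_
        rw [sum_const, nsmul_eq_mul, hg]
        rw [mul_one_div]
        exact div_self_le_one _
    _ = _ := by simp [card_powersetCard]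

/-- In a large hypergraph without vector Δ-systems, almost every `(k - 1)`-set extends to an edge
whose core is the new vertex. -/
theorem exists_core_vertices {H : Finset (Finset α)} {k d p : ℕ} {a : Fin p → ℕ} (hp : 2 ≤ p)
    (hpk : p < k) (hH : ∀ F ∈ H, F.card = k) (ha : ∀ i, 0 < a i) (hak : ∑ i, a i = k) (hd : p ≤ d)
    (hfree : VecFree a d H) (hn : 1 ≤ Fintype.card α)
    (hlarge : (Fintype.card α - 1).choose (k - 1) ≤ H.card) :
    ∃ (S : Finset (Finset α)) (f : Finset α → α), S ⊆ powersetCard (k - 1) univ ∧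
      (∀ T ∈ S, f T ∉ T ∧ insert (f T) T ∈ H ∧
        IsCore H (k * (d + 1)) (insert (f T) T) {f T}) ∧
      (Fintype.card α).choose (k - 1) ≤ S.card + (k + 1) *
        (2 ^ (k - 2) * (k * (d + 1) * (k * (d + 1))) + k * (d + 1) * (k * (d + 1)) + 1) *
          (Fintype.card α).choose (k - 2) := by
  classical
  set K := k * (d + 1) with hK
  set n := Fintype.card α with hn'
  set C := 2 ^ (k - 2) * (K * K) + K * K with hC
  obtain ⟨X, hXc, hX⟩ := exists_core_of_forall_not_mem H hH K
  -- Exchanges are counted inside `G`, so that the exchanged edge also has a core, as the exclusion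
  -- lemmas require.
  set G := H.filter fun E => ∃ M, IsCore H K E M with hGdef
  have hGH : G ⊆ H := filter_subset _ _
  have hGc : ∀ E ∈ G, E.card = k := fun E hE => hH E (hGH hE)
  have hHG : H.card ≤ G.card + n.choose (k - 2) * C := by
    have : H ⊆ G ∪ X := by
      intro E hE
      by_cases hEX : E ∈ X
      · exact mem_union_right _ hEX
      · exact mem_union_left _ (mem_filter.2 ⟨hE, hX E hE hEX⟩)
    exact (card_le_card this).trans ((card_union_le _ _).trans (by gcongr))
  have hcore : ∀ E, ∃ M, E ∈ G → IsCore H K E M := by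
    intro E
    by_cases hE : E ∈ G
    · obtain ⟨M, hM⟩ := (mem_filter.1 hE).2
      exact ⟨M, fun _ => hM⟩
    · exact ⟨∅, fun h => absurd h hE⟩
  choose c hc using hcore
  have hcpos : ∀ E ∈ G, 0 < (c E).card := fun E hE =>
    card_pos.2 ((hc E hE).nonempty hp hH ha hak hd hfree (hGH hE))
  have hsing : ∀ E ∈ G, ∀ x, c E = {x} → exchanges G E x = ∅ := by
    intro E hE x hx
    rw [eq_empty_iff_forall_notMem]
    intro y hy
    rw [exchanges, mem_filter] at hy
    exact (hx ▸ hc E hE).not_vecFree_of_singleton_exchange hp hpk hH ha hak hd (hGH hE) hy.2.1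
      (hGH hy.2.2) (hc _ hy.2.2) hfree
  have hw1 : ∀ E ∈ G, (c E).card = 1 → (1 : ℚ) ≤ ∑ x ∈ E, (1 : ℚ) / ((exchanges G E x).card + 1) := by
    intro E hE h1
    obtain ⟨x, hx⟩ := card_eq_one.1 h1
    have hxE : x ∈ E := (hc E hE).1 (by rw [hx]; simp)
    calc (1 : ℚ) = 1 / ((exchanges G E x).card + 1) := by rw [hsing E hE x hx]; simp
      _ ≤ _ := single_le_sum (f := fun x => (1 : ℚ) / ((exchanges G E x).card + 1))
        (fun _ _ => by positivity) hxE
  have hw2 : ∀ E ∈ G, (c E).card ≠ 1 →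
      (1 : ℚ) + 2 / k ≤ ∑ x ∈ E, (1 : ℚ) / ((exchanges G E x).card + 1) := by
    intro E hE h1
    have hcard : 2 ≤ (c E).card := by have := hcpos E hE; omega
    have hsub : ∑ x ∈ c E, (1 : ℚ) / ((exchanges G E x).card + 1) ≤
        ∑ x ∈ E, (1 : ℚ) / ((exchanges G E x).card + 1) :=
      sum_le_sum_of_subset_of_nonneg (hc E hE).1 fun _ _ _ => by positivity
    refine le_trans ?_ hsub
    by_cases hone : ∃ i, a i = 1
    · refine (hc E hE).le_sum_of_exists_eq_one hpk hH ha hak hd hfree (hGH hE) hcard hone _ ?_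
      intro x _ y hy
      rw [exchanges, mem_filter] at hy
      exact ⟨hy.2.1, hGH hy.2.2⟩
    push Not at hone
    by_cases htwo : ∀ i, a i = 2
    · have hemp : ∀ x ∈ c E, exchanges G E x = ∅ := by
        intro x hx
        rw [eq_empty_iff_forall_notMem]
        intro y hy
        rw [exchanges, mem_filter] at hy
        exact (hc E hE).not_vecFree_of_forall_eq_two hp hH htwo hak hd (hGH hE) hx hy.2.1
          (hGH hy.2.2) (hc _ hy.2.2) hfree
      have : ∑ x ∈ c E, (1 : ℚ) / ((exchanges G E x).card + 1) = (c E).card := by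
        rw [sum_congr rfl fun x hx => by rw [hemp x hx]]
        simp
      rw [this]
      have h2 : (2 : ℚ) ≤ (c E).card := by exact_mod_cast hcard
      have h3 : (2 : ℚ) / k ≤ 1 := by
        rw [div_le_one (by exact_mod_cast (by omega : 0 < k))]
        exact_mod_cast (by omega : 2 ≤ k)
      linarith
    · push Not at htwo
      have := (hc E hE).card_le_one hH ha hak hd hfree (hGH hE) (exists_two_le_part hpk hak) htwo
        hone
      omega
  set G₁ := G.filter fun E => (c E).card = 1 with hG₁
  set G₂ := G.filter fun E => ¬ (c E).card = 1 with hG₂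
  have hG12 : G₁.card + G₂.card = G.card := card_filter_add_card_filter_not _
  have hweight : (G₁.card : ℚ) + (1 + 2 / k) * G₂.card ≤ n.choose (k - 1) := by
    refine le_trans ?_ (sum_exchanges_le hGc)
    rw [← sum_filter_add_sum_filter_not G (fun E => (c E).card = 1)]
    refine add_le_add ?_ ?_
    · have := card_nsmul_le_sum G₁ (fun E => ∑ x ∈ E, (1 : ℚ) / ((exchanges G E x).card + 1)) 1
        fun E hE => hw1 E (mem_filter.1 hE).1 (mem_filter.1 hE).2
      simpa using this
    · have := card_nsmul_le_sum G₂ (fun E => ∑ x ∈ E, (1 : ℚ) / ((exchanges G E x).card + 1))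
        (1 + 2 / k) fun E hE => hw2 E (mem_filter.1 hE).1 (mem_filter.1 hE).2
      rw [nsmul_eq_mul, mul_comm] at this
      exact this
  have hpascal : n.choose (k - 1) ≤ H.card + n.choose (k - 2) := by
    obtain ⟨n', hn1⟩ : ∃ n', n = n' + 1 := ⟨n - 1, by omega⟩
    obtain ⟨k', hk1⟩ : ∃ k', k = k' + 2 := ⟨k - 2, by omega⟩
    rw [hn1, hk1] at hlarge ⊢
    simp only [Nat.add_sub_cancel, show k' + 2 - 1 = k' + 1 by omega] at hlarge ⊢
    rw [Nat.choose_succ_succ]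
    have := Nat.choose_le_choose k' (Nat.le_succ n')
    simp only [Nat.succ_eq_add_one] at *
    omega
  -- The excess weight 2/k of each edge of `G₂` must fit into the O(n^(k-2)) gap between C(n, k-1)
  -- and |G|.
  have hG₂c : G₂.card ≤ k * (C + 1) * n.choose (k - 2) := by
    have h1 : (n.choose (k - 1) : ℚ) ≤ G₁.card + G₂.card + n.choose (k - 2) * C +
        n.choose (k - 2) := by
      exact_mod_cast (by omega : n.choose (k - 1) ≤ G₁.card + G₂.card + n.choose (k - 2) * C +
        n.choose (k - 2))
    have h2 : (2 / k : ℚ) * G₂.card ≤ (C + 1) * n.choose (k - 2) := by linarith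
    have hk0 : (0 : ℚ) < k := by exact_mod_cast (by omega : 0 < k)
    have h3 : (2 : ℚ) * G₂.card ≤ k * ((C + 1) * n.choose (k - 2)) := by
      calc (2 : ℚ) * G₂.card = k * ((2 / k : ℚ) * G₂.card) := by field_simp
        _ ≤ _ := by gcongr
    have h4 : 2 * G₂.card ≤ k * ((C + 1) * n.choose (k - 2)) := by exact_mod_cast h3
    rw [mul_assoc]
    omega
  have hcx : ∀ E ∈ G₁, ∃ x, c E = {x} := fun E hE => card_eq_one.1 (mem_filter.1 hE).2
  -- Two edges with the same remainder would be exchanges of each other's core vertices.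
  have hinj : Set.InjOn (fun E => E \ c E) (G₁ : Set (Finset α)) := by
    intro E hE E' hE' h
    simp only at h
    obtain ⟨x, hx⟩ := hcx E hE
    obtain ⟨x', hx'⟩ := hcx E' hE'
    have hEG := (mem_filter.1 hE).1
    have hEG' := (mem_filter.1 hE').1
    have hxE : x ∈ E := (hc E hEG).1 (by rw [hx]; simp)
    have hxE' : x' ∈ E' := (hc E' hEG').1 (by rw [hx']; simp)
    rw [hx, hx', sdiff_singleton_eq_erase, sdiff_singleton_eq_erase] at h
    by_contra hne
    have hx'E : x' ∉ E := by
      intro hmem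
      by_cases hxx : x' = x
      · apply hne
        rw [← insert_erase hxE, h, hxx.symm, insert_erase hxE']
      · have : x' ∈ E.erase x := mem_erase.2 ⟨hxx, hmem⟩
        rw [h] at this
        exact (mem_erase.1 this).1 rfl
    have : x' ∈ exchanges G E x := by
      rw [exchanges, mem_filter, h, insert_erase hxE']
      exact ⟨mem_univ _, hx'E, hEG'⟩
    rw [hsing E hEG x hx] at this
    simp at this
  set S := G₁.image fun E => E \ c E with hS
  have hScard : S.card = G₁.card := card_image_of_injOn hinj
  have : Nonempty α := Fintype.card_pos_iff.1 hn
  have hf : ∀ T, ∃ x, T ∈ S → x ∉ T ∧ insert x T ∈ H ∧ IsCore H K (insert x T) {x} := by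
    intro T
    by_cases hT : T ∈ S
    · obtain ⟨E, hE, rfl⟩ := mem_image.1 hT
      obtain ⟨x, hx⟩ := hcx E hE
      have hEG := (mem_filter.1 hE).1
      have hxE : x ∈ E := (hc E hEG).1 (by rw [hx]; simp)
      refine ⟨x, fun _ => ?_⟩
      rw [hx, sdiff_singleton_eq_erase, insert_erase hxE]
      exact ⟨by simp, hGH hEG, hx ▸ hc E hEG⟩
    · exact ⟨Classical.arbitrary α, fun h => absurd h hT⟩
  choose f hf using hf
  refine ⟨S, f, ?_, hf, ?_⟩
  · intro T hT
    obtain ⟨E, hE, rfl⟩ := mem_image.1 hT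
    have hEG := (mem_filter.1 hE).1
    rw [mem_powersetCard]
    refine ⟨subset_univ _, ?_⟩
    rw [card_sdiff_of_subset (hc E hEG).1, hGc E hEG, (mem_filter.1 hE).2]
  · rw [hScard]
    have : (k + 1) * (C + 1) * n.choose (k - 2) =
      k * (C + 1) * n.choose (k - 2) + (n.choose (k - 2) * C + n.choose (k - 2)) := by ring
    rw [this]
    omega

end
-- The core vertex is almost always the same.
section
open Finset

variable {α : Type*} [DecidableEq α]

/-- A function on the `r`-subsets of a `2r`-set that takes equal values on sets meeting in `r - j`
elements is constant. -/
theorem eq_of_forall_card_inter_eq {β : Type*} {W : Finset α} {r j : ℕ} (hW : W.card = 2 * r)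
    (hj : 1 ≤ j) (hjr : j < r) (f : Finset α → β)
    (h : ∀ P ∈ powersetCard r W, ∀ Q ∈ powersetCard r W, (P ∩ Q).card = r - j → f P = f Q) :
    ∀ P ∈ powersetCard r W, ∀ Q ∈ powersetCard r W, f P = f Q := by
  have hadj : ∀ P ∈ powersetCard r W, ∀ Q ∈ powersetCard r W, (P ∩ Q).card + 1 = r →
      f P = f Q := by
    intro P hP Q hQ hPQ
    have hP' := mem_powersetCard.1 hP
    have hQ' := mem_powersetCard.1 hQ
    -- Sets differing in one element have a common neighbour `R ∪ J` that meets each of them exactly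
    -- in `R`; there is room for `J` because |W \ (P ∪ Q)| = r - 1 ≥ j.
    obtain ⟨R, hR, hRc⟩ := exists_subset_card_eq (s := P ∩ Q) (n := r - j) (by omega)
    obtain ⟨J, hJ, hJc⟩ := exists_subset_card_eq (s := W \ (P ∪ Q)) (n := j) (by
      rw [card_sdiff_of_subset (union_subset hP'.1 hQ'.1)]
      have := card_union_add_card_inter P Q
      omega)
    have hRP := hR.trans inter_subset_left
    have hRQ := hR.trans inter_subset_right
    have hJP : Disjoint J P := disjoint_of_subset_left hJ
      (disjoint_of_subset_right subset_union_left sdiff_disjoint)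
    have hJQ : Disjoint J Q := disjoint_of_subset_left hJ
      (disjoint_of_subset_right subset_union_right sdiff_disjoint)
    have hmem : R ∪ J ∈ powersetCard r W := by
      rw [mem_powersetCard, card_union_of_disjoint (disjoint_of_subset_left hRP hJP.symm), hRc, hJc]
      exact ⟨union_subset (hRP.trans hP'.1) (hJ.trans sdiff_subset), by omega⟩
    have h1 : P ∩ (R ∪ J) = R := by
      rw [inter_union_distrib_left, inter_eq_right.2 hRP, disjoint_iff_inter_eq_empty.1 hJP.symm, union_empty]
    have h2 : Q ∩ (R ∪ J) = R := by
      rw [inter_union_distrib_left, inter_eq_right.2 hRQ, disjoint_iff_inter_eq_empty.1 hJQ.symm, union_empty]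
    rw [h P hP _ hmem (by rw [h1, hRc]), h Q hQ _ hmem (by rw [h2, hRc])]
  have key : ∀ c, ∀ P ∈ powersetCard r W, ∀ Q ∈ powersetCard r W, (P \ Q).card = c →
      f P = f Q := by
    intro c
    induction c with
    | zero =>
      intro P hP Q hQ h0
      rw [mem_powersetCard] at hP hQ
      rw [eq_of_subset_of_card_le (sdiff_eq_empty_iff_subset.1 (card_eq_zero.1 h0))
        (by rw [hP.2, hQ.2])]
    | succ c ih =>
      intro P hP Q hQ hc
      have hP' := mem_powersetCard.1 hP
      have hQ' := mem_powersetCard.1 hQ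
      obtain ⟨u, hu⟩ := card_pos.1 (by omega : 0 < (P \ Q).card)
      obtain ⟨v, hv⟩ := card_pos.1 (by
        rw [← card_sdiff_comm (hP'.2.trans hQ'.2.symm)]; omega : 0 < (Q \ P).card)
      rw [mem_sdiff] at hu hv
      have hvP : v ∉ P.erase u := fun h => hv.2 (mem_erase.1 h).2
      have hmem : insert v (P.erase u) ∈ powersetCard r W := by
        rw [mem_powersetCard, card_insert_of_notMem hvP, card_erase_of_mem hu.1, hP'.2]
        refine ⟨insert_subset (hQ'.1 hv.1) ((erase_subset _ _).trans hP'.1), by omega⟩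
      rw [hadj P hP _ hmem, ih _ hmem Q hQ]
      · have : insert v (P.erase u) \ Q = (P \ Q).erase u := by
          ext w
          simp only [mem_sdiff, mem_insert, mem_erase]
          constructor
          · rintro ⟨rfl | h, hw⟩
            · exact absurd hv.1 hw
            · exact ⟨h.1, h.2, hw⟩
          · exact fun h => ⟨Or.inr ⟨h.1, h.2.1⟩, h.2.2⟩
        rw [this, card_erase_of_mem (mem_sdiff.2 hu), hc]
        rfl
      · have : P ∩ insert v (P.erase u) = P.erase u := by
          ext w
          simp only [mem_inter, mem_insert, mem_erase]
          constructor
          · rintro ⟨hw, rfl | h⟩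
            · exact absurd hw hv.2
            · exact h
          · exact fun h => ⟨h.2, Or.inr h⟩
        rw [this, card_erase_of_mem hu.1, hP'.2]
        omega
  exact fun P hP Q hQ => key _ P hP Q hQ rfl

variable [Fintype α]

theorem card_filter_superset_le (T : Finset α) (N : ℕ) :
    ((powersetCard N univ).filter fun W => T ⊆ W).card ≤ Fintype.card α ^ (N - T.card) := by
  have h1 : ((powersetCard N univ).filter fun W => T ⊆ W).card ≤
      (powersetCard (N - T.card) (univ : Finset α)).card := by
    refine card_le_card_of_injOn (fun W => W \ T) ?_ ?_
    · intro W hW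
      simp only [coe_filter, mem_powersetCard, Set.mem_ofPred_eq] at hW
      rw [mem_coe, mem_powersetCard, card_sdiff_of_subset hW.2, hW.1.2]
      exact ⟨subset_univ _, rfl⟩
    · intro W hW W' hW' h
      simp only [coe_filter, mem_powersetCard, Set.mem_ofPred_eq] at hW hW' h
      rw [← union_sdiff_of_subset hW.2, h, union_sdiff_of_subset hW'.2]
  refine h1.trans ?_
  rw [card_powersetCard, card_univ]
  exact Nat.choose_le_pow _ _

theorem pow_le_mul_choose {n r : ℕ} (h : 2 * r ≤ n) :
    n ^ r ≤ 2 ^ r * r.factorial * n.choose r := by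
  have h1 := Nat.pow_le_choose (α := ℚ) r n
  rw [div_le_iff₀' (by exact_mod_cast r.factorial_pos)] at h1
  calc n ^ r ≤ (2 * (n + 1 - r)) ^ r := Nat.pow_le_pow_left (by omega) r
    _ = 2 ^ r * (n + 1 - r) ^ r := mul_pow _ _ _
    _ ≤ 2 ^ r * (r.factorial * n.choose r) := by
        gcongr
        exact_mod_cast h1
    _ = _ := by ring

/-- Inside a good `2r`-set, all of whose `r`-subsets `T` lie in `S` with `f T` outside the set,
`hrel` leaves only equality, so `f` is constant there. Few `2r`-sets are bad, so by averaging some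
`T₀` has a good union with all but O(n^(r-1)) of the `r`-sets disjoint from it. -/
theorem exists_dominant_value {r j C : ℕ} (hj : 1 ≤ j) (hjr : j < r) (S : Finset (Finset α))
    (hS : S ⊆ powersetCard r univ) (f : Finset α → α) (hf : ∀ T ∈ S, f T ∉ T)
    (hrel : ∀ T ∈ S, ∀ T' ∈ S, (T ∩ T').card = r - j → f T = f T' ∨ f T ∈ T' ∨ f T' ∈ T)
    (hC : (Fintype.card α).choose r ≤ S.card + C * Fintype.card α ^ (r - 1))
    (hn : 2 * r ≤ Fintype.card α) :
    ∃ x, ((powersetCard r univ).filter fun T => ¬ (T ∈ S ∧ f T = x)).card ≤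
      (4 ^ r * (C + 1) * (2 ^ r * r.factorial) + r) * Fintype.card α ^ (r - 1) := by
  classical
  set n := Fintype.card α with hn'
  set P : Finset (Finset α) := powersetCard r univ with hP
  have hPc : P.card = n.choose r := by rw [hP, card_powersetCard, card_univ]
  have hPS : (P \ S).card ≤ C * n ^ (r - 1) := by
    rw [card_sdiff_of_subset hS, hPc]; omega
  have hScard : S.card ≤ n ^ r := (card_le_card hS).trans (hPc ▸ Nat.choose_le_pow _ _)
  set bad := (powersetCard (2 * r) (univ : Finset α)).filter
    fun W => ¬ ∀ T ∈ powersetCard r W, T ∈ S ∧ f T ∉ W with hbad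
  have hbadc : bad.card ≤ (C + 1) * n ^ (r - 1) * n ^ r := by
    have hsub : bad ⊆
        ((P \ S).biUnion fun T => (powersetCard (2 * r) univ).filter fun W => T ⊆ W) ∪
          S.biUnion fun T => (powersetCard (2 * r) univ).filter fun W => insert (f T) T ⊆ W := by
      intro W hW
      rw [hbad, mem_filter] at hW
      obtain ⟨hW, hb⟩ := hW
      push Not at hb
      obtain ⟨T, hT, hTS⟩ := hb
      rw [mem_powersetCard] at hT
      rw [mem_union, mem_biUnion, mem_biUnion]
      by_cases h : T ∈ S
      · exact Or.inr ⟨T, h, mem_filter.2 ⟨hW, insert_subset (hTS h) hT.1⟩⟩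
      · exact Or.inl ⟨T, mem_sdiff.2 ⟨mem_powersetCard.2 ⟨subset_univ _, hT.2⟩, h⟩,
          mem_filter.2 ⟨hW, hT.1⟩⟩
    refine (card_le_card hsub).trans ((card_union_le _ _).trans ?_)
    have h1 : ((P \ S).biUnion fun T =>
        (powersetCard (2 * r) univ).filter fun W => T ⊆ W).card ≤ C * n ^ (r - 1) * n ^ r := by
      refine (card_biUnion_le_card_mul _ _ (n ^ r) fun T hT => ?_).trans (by gcongr)
      refine (card_filter_superset_le _ _).trans ?_
      rw [(mem_powersetCard.1 (mem_sdiff.1 hT).1).2, two_mul, Nat.add_sub_cancel]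
    have h2 : (S.biUnion fun T => (powersetCard (2 * r) univ).filter
        fun W => insert (f T) T ⊆ W).card ≤ n ^ r * n ^ (r - 1) := by
      refine (card_biUnion_le_card_mul _ _ (n ^ (r - 1)) fun T hT => ?_).trans (by gcongr)
      refine (card_filter_superset_le _ _).trans ?_
      rw [card_insert_of_notMem (hf T hT), (mem_powersetCard.1 (hS hT)).2,
        show 2 * r - (r + 1) = r - 1 by omega]
    calc _ ≤ C * n ^ (r - 1) * n ^ r + n ^ r * n ^ (r - 1) := add_le_add h1 h2
      _ = _ := by ring
  set B : Finset α → Finset (Finset α) := fun T =>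
    P.filter fun T' => Disjoint T T' ∧ T ∪ T' ∈ bad with hB
  have hpairs : ∑ T ∈ P, (B T).card ≤ 4 ^ r * ((C + 1) * n ^ (r - 1) * n ^ r) := by
    rw [← card_sigma]
    have hsub : P.sigma B ⊆ bad.biUnion fun W => W.powerset.image fun T => ⟨T, W \ T⟩ := by
      rintro ⟨T, T'⟩ h
      rw [mem_sigma] at h
      simp only [hB, mem_filter] at h
      rw [mem_biUnion]
      refine ⟨T ∪ T', h.2.2.2, mem_image.2 ⟨T, mem_powerset.2 subset_union_left, ?_⟩⟩
      rw [union_sdiff_left, h.2.2.1.symm.sdiff_eq_left]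
    refine (card_le_card hsub).trans ?_
    refine (card_biUnion_le_card_mul _ _ (4 ^ r) fun W hW => card_image_le.trans ?_).trans ?_
    · rw [card_powerset, (mem_powersetCard.1 (mem_filter.1 hW).1).2, pow_mul]
      norm_num
    · rw [mul_comm]; gcongr
  have hPpos : 0 < P.card := by rw [hPc]; exact Nat.choose_pos (by omega)
  obtain ⟨T₀, hT₀, hBT₀⟩ : ∃ T₀ ∈ P,
      (B T₀).card ≤ 4 ^ r * (C + 1) * (2 ^ r * r.factorial) * n ^ (r - 1) := by
    by_contra! h
    have h1 := card_nsmul_le_sum P (fun T => (B T).card) _ fun T hT => Nat.succ_le_of_lt (h T hT)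
    have h2 := pow_le_mul_choose hn
    rw [← hPc] at h2
    have h3 : 4 ^ r * ((C + 1) * n ^ (r - 1) * n ^ r) ≤
        P.card * (4 ^ r * (C + 1) * (2 ^ r * r.factorial) * n ^ (r - 1)) := by
      calc 4 ^ r * ((C + 1) * n ^ (r - 1) * n ^ r)
          ≤ 4 ^ r * ((C + 1) * n ^ (r - 1) * (2 ^ r * r.factorial * P.card)) := by gcongr
        _ = _ := by ring
    rw [smul_eq_mul, Nat.succ_eq_add_one, mul_add] at h1
    omega
  refine ⟨f T₀, ?_⟩
  have hsub : (P.filter fun T => ¬ (T ∈ S ∧ f T = f T₀)) ⊆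
      B T₀ ∪ T₀.biUnion fun v => P.filter fun T => {v} ⊆ T := by
    intro T hT
    rw [mem_filter] at hT
    rw [mem_union, mem_biUnion]
    by_contra! h
    apply hT.2
    have hdis : Disjoint T₀ T := by
      rw [disjoint_left]
      exact fun v hv hvT => h.2 v hv (mem_filter.2 ⟨hT.1, by simpa using hvT⟩)
    have hgood : T₀ ∪ T ∉ bad := fun hb => h.1 (mem_filter.2 ⟨hT.1, hdis, hb⟩)
    have hWc : (T₀ ∪ T).card = 2 * r := by
      rw [card_union_of_disjoint hdis, (mem_powersetCard.1 hT₀).2, (mem_powersetCard.1 hT.1).2]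
      ring
    rw [hbad, mem_filter, not_and, not_not] at hgood
    have hgood := hgood (mem_powersetCard.2 ⟨subset_univ _, hWc⟩)
    have hTW : T ∈ powersetCard r (T₀ ∪ T) :=
      mem_powersetCard.2 ⟨subset_union_right, (mem_powersetCard.1 hT.1).2⟩
    refine ⟨(hgood T hTW).1, ?_⟩
    refine eq_of_forall_card_inter_eq hWc hj hjr f ?_ T hTW T₀
      (mem_powersetCard.2 ⟨subset_union_left, (mem_powersetCard.1 hT₀).2⟩)
    intro Q hQ Q' hQ' hQQ
    rcases hrel Q (hgood Q hQ).1 Q' (hgood Q' hQ').1 hQQ with h | h | h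
    · exact h
    · exact absurd ((mem_powersetCard.1 hQ').1 h) (hgood Q hQ).2
    · exact absurd ((mem_powersetCard.1 hQ).1 h) (hgood Q' hQ').2
  refine (card_le_card hsub).trans ((card_union_le _ _).trans ?_)
  rw [add_mul]
  refine add_le_add hBT₀ ?_
  refine (card_biUnion_le_card_mul _ _ (n ^ (r - 1)) fun v _ => ?_).trans ?_
  · simpa using card_filter_superset_le {v} r
  · rw [(mem_powersetCard.1 hT₀).2]

end
-- Shadows, and the cost of edges avoiding the centre.
section
open Finset
open scoped FinsetFamily

variable {α : Type*} [DecidableEq α]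

/-- If all sets in the shadow of `G` have large degree, then all subsets of edges are robust. -/
theorem robust_of_forall_shadow {G : Finset (Finset α)} {k K : ℕ} (hG : ∀ E ∈ G, E.card = k)
    (hdeg : ∀ S ∈ ∂ G, K < (G.filter fun F => S ⊆ F).card) {E Q : Finset α} (hE : E ∈ G)
    (hQ : Q ⊆ E) : Robust G K Q := by
  intro Z hZ hZQ
  -- Vertices of `F ∩ Z` are exchanged one at a time: a degree above `K ≥ |Z|` always offers a
  -- replacement outside `Z`.
  suffices h : ∀ c, ∀ F ∈ G, Q ⊆ F → (F ∩ Z).card = c → ∃ F ∈ G, Q ⊆ F ∧ Disjoint F Z from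
    h _ E hE hQ rfl
  intro c
  induction c with
  | zero =>
    intro F hF hQF hc
    exact ⟨F, hF, hQF, disjoint_iff_inter_eq_empty.2 (card_eq_zero.1 hc)⟩
  | succ c ih =>
    intro F hF hQF hc
    obtain ⟨v, hv⟩ := card_pos.1 (by omega : 0 < (F ∩ Z).card)
    have hvF := (mem_inter.1 hv).1
    have hvZ := (mem_inter.1 hv).2
    have hQv : Q ⊆ F.erase v := fun w hw =>
      mem_erase.2 ⟨fun h => disjoint_left.1 hZQ hvZ (h ▸ hw), hQF hw⟩
    obtain ⟨u, huZ, huG⟩ : ∃ u, u ∉ Z ∧ insert u (F.erase v) ∈ G := by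
      by_contra! h
      have hsub : (G.filter fun F' => F.erase v ⊆ F') ⊆ Z.image fun u => insert u (F.erase v) := by
        intro F' hF'
        rw [mem_filter] at hF'
        obtain ⟨u, hu⟩ : ∃ u, F' \ F.erase v = {u} := by
          rw [← card_eq_one, card_sdiff_of_subset hF'.2, card_erase_of_mem hvF, hG F hF,
            hG F' hF'.1]
          have := card_pos.2 ⟨v, hvF⟩
          rw [hG F hF] at this
          omega
        have hFu : insert u (F.erase v) = F' := by
          rw [← union_sdiff_of_subset hF'.2, hu, union_comm, singleton_union]
        refine mem_image.2 ⟨u, ?_, hFu⟩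
        by_contra huZ
        exact h u huZ (hFu ▸ hF'.1)
      have h1 := hdeg _ (erase_mem_shadow hF hvF)
      have h2 := (card_le_card hsub).trans card_image_le
      omega
    refine ih _ huG (hQv.trans (subset_insert _ _)) ?_
    have : insert u (F.erase v) ∩ Z = (F ∩ Z).erase v := by
      rw [insert_inter_of_notMem huZ, erase_inter]
    rw [this, card_erase_of_mem hv, hc]
    rfl

/-- Deleting all edges through a shadow set of degree at most `K` costs at most `K` edges and
removes that set from the shadow. If no such set exists in a nonempty family, every subset of an
edge is robust and a Δ-system appears. -/
theorem VecFree.card_le_mul_card_shadow {k d p : ℕ} {a : Fin p → ℕ} (hp : 0 < p)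
    (ha : ∀ i, 0 < a i) (hak : ∑ i, a i = k) (hd : p ≤ d) (G : Finset (Finset α))
    (hG : ∀ E ∈ G, E.card = k) (hfree : VecFree a d G) :
    G.card ≤ k * (d + 1) * (∂ G).card := by
  induction hc : G.card using Nat.strong_induction_on generalizing G with
  | _ c ih =>
    subst hc
    by_contra! hlt
    by_cases hdeg : ∀ S ∈ ∂ G, k * (d + 1) < (G.filter fun F => S ⊆ F).card
    · obtain ⟨E, hE⟩ := card_pos.1 (by omega : 0 < G.card)
      obtain ⟨A, hA, -⟩ := exists_vecPartition_extension (M := ∅) (empty_subset E)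
        (hak.trans (hG E hE).symm) ∅ (fun _ => ∅) (by simp) (by simp) (fun _ => 0) (by simp)
        (by simp)
      exact exists_vecNumDeltaSystem hG ha hd hE hA (I := ∅) ⟨⟨0, hp⟩, by simp⟩ (fun _ => ∅)
        (by simp) (by simp) (fun i _ => robust_of_forall_shadow hG hdeg hE sdiff_subset) hfree
    · push Not at hdeg
      obtain ⟨S, hS, hSK⟩ := hdeg
      set G' := G.filter fun F => ¬ S ⊆ F with hG'
      have hsplit : (G.filter fun F => S ⊆ F).card + G'.card = G.card :=
        card_filter_add_card_filter_not _
      have hsh : ∂ G' ⊆ (∂ G).erase S := by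
        intro T hT
        refine mem_erase.2 ⟨?_, shadow_mono (filter_subset _ _) hT⟩
        rintro rfl
        obtain ⟨F, hF, hTF⟩ := exists_subset_of_mem_shadow hT
        exact (mem_filter.1 hF).2 hTF
      have hshc := card_le_card hsh
      rw [card_erase_of_mem hS] at hshc
      have hSpos : 0 < (∂ G).card := card_pos.2 ⟨S, hS⟩
      have hpos : 0 < (G.filter fun F => S ⊆ F).card := by
        obtain ⟨F, hF, hSF⟩ := exists_subset_of_mem_shadow hS
        exact card_pos.2 ⟨F, mem_filter.2 ⟨hF, hSF⟩⟩
      have h1 := ih G'.card (by omega) G' (fun E hE => hG E (mem_filter.1 hE).1)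
        (hfree.mono (filter_subset _ _)) rfl
      have h2 : k * (d + 1) * (∂ G').card ≤ k * (d + 1) * ((∂ G).card - 1) := by gcongr
      rw [Nat.mul_sub, mul_one] at h2
      have h3 : k * (d + 1) ≤ k * (d + 1) * (∂ G).card := Nat.le_mul_of_pos_right _ hSpos
      omega

theorem pow_le_four_pow_mul_choose {n m s : ℕ} (hs : 2 * s ≤ m) (hm : n ≤ 2 * m) :
    n ^ s ≤ 4 ^ s * s.factorial * m.choose s := by
  calc n ^ s ≤ (2 * m) ^ s := Nat.pow_le_pow_left hm s
    _ = 2 ^ s * m ^ s := mul_pow _ _ _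
    _ ≤ 2 ^ s * (2 ^ s * s.factorial * m.choose s) := by gcongr; exact pow_le_mul_choose hs
    _ = (2 * 2) ^ s * s.factorial * m.choose s := by rw [mul_pow]; ring
    _ = _ := by norm_num

theorem sum_card_filter_superset_le {k : ℕ} (M N : Finset (Finset α))
    (hM : ∀ T ∈ M, T.card ≤ k) :
    ∑ R ∈ N, (M.filter fun T => R ⊆ T).card ≤ M.card * 2 ^ k := by
  have h1 : ∑ R ∈ N, (M.filter fun T => R ⊆ T).card = ∑ T ∈ M, (N.filter fun R => R ⊆ T).card :=
    sum_card_bipartiteAbove_eq_sum_card_bipartiteBelow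
      (fun (R : Finset α) (T : Finset α) => R ⊆ T)
  rw [h1, ← smul_eq_mul]
  refine sum_le_card_nsmul _ _ _ fun T hT => ?_
  have h2 : (N.filter fun R => R ⊆ T) ⊆ T.powerset := fun R hR =>
    mem_powerset.2 (mem_filter.1 hR).2
  refine (card_le_card h2).trans ?_
  rw [card_powerset]
  exact Nat.pow_le_pow_right (by norm_num) (hM T hT)

variable [Fintype α]

/-- If every extension of `R` by a set outside `W` belongs to `P`, then `P` has many members
containing `R`. -/
theorem pow_le_mul_card_filter_superset {P : Finset (Finset α)} {R W : Finset α} {r k : ℕ}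
    (hRr : R.card ≤ r) (hrk : r ≤ k) (hRW : R ⊆ W) (hW : 2 * W.card ≤ Fintype.card α)
    (hn : 4 * k ≤ Fintype.card α)
    (h : ∀ J : Finset α, Disjoint J W → J.card = r - R.card → R ∪ J ∈ P) :
    Fintype.card α ^ (r - R.card) ≤
      4 ^ k * k.factorial * (P.filter fun T => R ⊆ T).card := by
  have h1 : (powersetCard (r - R.card) Wᶜ).card ≤ (P.filter fun T => R ⊆ T).card := by
    refine card_le_card_of_injOn (fun J => R ∪ J) ?_ ?_
    · intro J hJ
      rw [mem_coe, mem_powersetCard] at hJ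
      rw [mem_coe, mem_filter]
      exact ⟨h J (disjoint_of_subset_left hJ.1 disjoint_compl_left) hJ.2, subset_union_left⟩
    · intro J hJ J' hJ' hJJ
      rw [mem_coe, mem_powersetCard] at hJ hJ'
      have h2 : ∀ J ⊆ Wᶜ, (R ∪ J) \ R = J := fun J hJ => by
        rw [union_sdiff_left]
        exact (disjoint_of_subset_left hJ
          (disjoint_of_subset_right hRW disjoint_compl_left)).sdiff_eq_left
      simp only at hJJ
      rw [← h2 J hJ.1, hJJ, h2 J' hJ'.1]
  rw [card_powersetCard, card_compl] at h1
  calc Fintype.card α ^ (r - R.card)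
      ≤ 4 ^ (r - R.card) * (r - R.card).factorial *
        (Fintype.card α - W.card).choose (r - R.card) :=
        pow_le_four_pow_mul_choose (by omega) (by omega)
    _ ≤ _ := by
        gcongr
        · norm_num
        · omega
        · omega

/-- If few edges through `x` are missing and not more than there are edges avoiding `x`, then the
lower shadow of the edges avoiding `x` is small. -/
theorem card_shadow_mul_pow_le {H : Finset (Finset α)} {k d p : ℕ} {a : Fin p → ℕ} (hp : 2 ≤ p)
    (hH : ∀ F ∈ H, F.card = k) (ha : ∀ i, 0 < a i) (hak : ∑ i, a i = k) (hd : p ≤ d)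
    (hfree : VecFree a d H) (x : α) (i : Fin p) (hn : 4 * (k * (d + 1) + k + 1) ≤ Fintype.card α)
    (N : Finset (Finset α)) (hN : ∀ R ∈ N, R.card = k - a i ∧ ∃ E ∈ H, x ∉ E ∧ R ⊆ E) :
    N.card * Fintype.card α ^ (a i - 1) ≤
      4 ^ k * k.factorial * 2 ^ k * (1 + 4 ^ k * k.factorial * 2 ^ k) *
        ((powersetCard (k - 1) (univ.erase x)).filter fun T => insert x T ∉ H).card := by
  classical
  set K := k * (d + 1) with hK
  set n := Fintype.card α with hn'
  set c := 4 ^ k * k.factorial with hc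
  have hai := part_lt hp ha hak i
  have hai0 := ha i
  set P : Finset (Finset α) := powersetCard (k - 1) (univ.erase x) with hP
  have hPmem : ∀ T, T ∈ P ↔ x ∉ T ∧ T.card = k - 1 := by
    intro T
    rw [hP, mem_powersetCard, subset_erase]
    simp
  set Mis := P.filter fun T => insert x T ∉ H with hMis
  -- Sets `R` for which `insert x R` is blocked: every extension of `R` avoiding the blocker is
  -- missing, so each poor set lies in a positive proportion of missing sets.
  set poor : Finset (Finset α) :=
    univ.filter fun R => x ∉ R ∧ R.card ≤ k - 2 ∧ ¬ Robust H K (insert x R) with hpoor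
  have hpoorc : ∀ R ∈ poor, n ^ (k - 1 - R.card) ≤ c * (Mis.filter fun T => R ⊆ T).card := by
    intro R hR
    obtain ⟨-, hxR, hRc, hR⟩ := mem_filter.1 hR
    unfold Robust at hR
    push Not at hR
    obtain ⟨Z, hZ, hZR, hZF⟩ := hR
    have hcard : (insert x R ∪ Z).card ≤ (k - 2 + 1) + K :=
      (card_union_le _ _).trans (add_le_add ((card_insert_le _ _).trans (by omega)) hZ)
    refine pow_le_mul_card_filter_superset (W := insert x R ∪ Z) (by omega) (by omega)
      ((subset_insert _ _).trans subset_union_left) (by omega) (by omega) fun J hJ hJc => ?_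
    rw [disjoint_union_right, disjoint_insert_right] at hJ
    rw [hMis, mem_filter, hPmem, card_union_of_disjoint hJ.1.2.symm, mem_union, not_or]
    refine ⟨⟨⟨hxR, hJ.1.1⟩, by omega⟩, fun hmem => ?_⟩
    refine hZF _ hmem (insert_subset_insert _ subset_union_left) ?_
    rw [disjoint_insert_right] at hZR
    rw [disjoint_insert_left, disjoint_union_left]
    exact ⟨hZR.1, hZR.2.symm, hJ.2⟩
  -- By double counting, adding all supersets of poor sets enlarges `Mis` only by a constant factor.
  -- Outside `Mis'`, `insert x T` is an edge with core `{x}`.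
  set Mis' := P.filter fun T => T ∈ Mis ∨ ∃ R ∈ poor, R ⊆ T with hMis'
  have hMis'c : Mis'.card ≤ (1 + c * 2 ^ k) * Mis.card := by
    have hsub : Mis' ⊆ Mis ∪ poor.biUnion fun R =>
        (powersetCard (k - 1) univ).filter fun T => R ⊆ T := by
      intro T hT
      obtain ⟨hTP, hT⟩ := mem_filter.1 hT
      rw [mem_union, mem_biUnion]
      rcases hT with hT | ⟨R, hR, hRT⟩
      · exact Or.inl hT
      · exact Or.inr ⟨R, hR, mem_filter.2
          ⟨mem_powersetCard.2 ⟨subset_univ _, ((hPmem T).1 hTP).2⟩, hRT⟩⟩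
    refine (card_le_card hsub).trans ((card_union_le _ _).trans ?_)
    rw [add_mul, one_mul]
    refine add_le_add le_rfl ?_
    calc _ ≤ ∑ R ∈ poor, n ^ (k - 1 - R.card) :=
          card_biUnion_le.trans (sum_le_sum fun R _ => card_filter_superset_le R (k - 1))
      _ ≤ ∑ R ∈ poor, c * (Mis.filter fun T => R ⊆ T).card := sum_le_sum hpoorc
      _ = c * ∑ R ∈ poor, (Mis.filter fun T => R ⊆ T).card := by rw [mul_sum]
      _ ≤ c * (Mis.card * 2 ^ k) := by
          gcongr
          refine sum_card_filter_superset_le _ _ fun T hT => ?_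
          rw [((hPmem T).1 (mem_filter.1 hT).1).2]
          omega
      _ = _ := by ring
  -- If `T ⊇ R` has no further vertex of `E` and lies outside `Mis'`, the edge `insert x T` meets
  -- `E` exactly in `R`, in `k - a i` vertices, which is forbidden.
  have hNR : ∀ R ∈ N, n ^ (a i - 1) ≤ c * (Mis'.filter fun T => R ⊆ T).card := by
    intro R hR
    obtain ⟨hRc, E, hE, hxE, hRE⟩ := hN R hR
    have hxR : x ∉ R := fun h => hxE (hRE h)
    have := pow_le_mul_card_filter_superset (P := Mis') (R := R) (W := insert x E) (r := k - 1)
      (k := k) (by omega) (by omega) (hRE.trans (subset_insert _ _))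
      (by rw [card_insert_of_notMem hxE, hH E hE]; omega) (by omega) fun J hJ hJc => ?_
    · rwa [hRc, show k - 1 - (k - a i) = a i - 1 by omega] at this
    rw [disjoint_insert_right] at hJ
    have hRJ : Disjoint R J := disjoint_of_subset_left hRE hJ.2.symm
    have hTP : R ∪ J ∈ P := by
      rw [hPmem, card_union_of_disjoint hRJ, mem_union, not_or]
      exact ⟨⟨hxR, hJ.1⟩, by omega⟩
    have hxT := ((hPmem _).1 hTP).1
    have hTc := ((hPmem _).1 hTP).2
    by_contra hT
    rw [hMis', mem_filter, not_and, not_or, hMis, mem_filter, not_and, not_not] at hT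
    obtain ⟨hTH, hTpoor⟩ := hT hTP
    push Not at hTpoor
    refine IsCore.not_vecFree_of_singleton hp hH ha hak hd (hTH hTP) (x := x) ?_ hE hxE (i := i) ?_
      hfree
    · refine ⟨by simp, fun A hA hAne hAx => ?_⟩
      have hxA : x ∉ A := by
        intro hxA
        apply hAx
        rw [inter_singleton_of_mem hxA, card_singleton]
      have hAT : A ⊆ R ∪ J := (subset_insert_iff_of_notMem hxA).1 hA
      rw [insert_sdiff_of_notMem _ hxA]
      by_contra hnr
      refine hTpoor ((R ∪ J) \ A) (mem_filter.2 ⟨mem_univ _, fun h => hxT (mem_sdiff.1 h).1, ?_,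
        hnr⟩) sdiff_subset
      rw [card_sdiff_of_subset hAT, hTc]
      have := card_pos.2 hAne
      omega
    · rw [insert_inter_of_notMem hxE, union_inter_distrib_right, inter_eq_left.2 hRE,
        disjoint_iff_inter_eq_empty.1 hJ.2, union_empty, hRc]
  calc N.card * n ^ (a i - 1) = ∑ _R ∈ N, n ^ (a i - 1) := by rw [sum_const, smul_eq_mul]
    _ ≤ ∑ R ∈ N, c * (Mis'.filter fun T => R ⊆ T).card := sum_le_sum hNR
    _ ≤ c * (Mis'.card * 2 ^ k) := by
        rw [← mul_sum]
        gcongr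
        refine sum_card_filter_superset_le _ _ fun T hT => ?_
        rw [((hPmem T).1 (mem_filter.1 hT).1).2]
        omega
    _ ≤ c * ((1 + c * 2 ^ k) * Mis.card * 2 ^ k) := by gcongr
    _ = _ := by ring

end
-- Kruskal–Katona and the conclusion.
section
open Finset
open scoped FinsetFamily

/-- A nonempty family of `r`-sets whose iterated shadow is both sparse and not much larger than
the trivial bound lives on boundedly many vertices. -/
theorem le_of_card_shadow_le {n r j A C : ℕ} (hj : 1 ≤ j) (hjr : j < r) (hA : 1 ≤ A)
    (T : Finset (Finset (Fin n))) (hT : (T : Set (Finset (Fin n))).Sized r) (hne : T.Nonempty)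
    (h1 : (∂^[j] T).card * n ^ j ≤ A * T.card) (h2 : (∂^[j] T).card ≤ C * n ^ (r - j - 1)) :
    n ≤ (A * 2 ^ r * r ^ r * r.factorial) ^ r * (r ^ r * r.factorial) * C := by
  set N := (∂^[j] T).card with hN
  set h := r - j with hh
  have hTn : T.card ≤ n.choose r := by simpa using hT.card_le
  have hTpos : 1 ≤ T.card := card_pos.2 hne
  have hrn : r ≤ n := by
    by_contra! hlt
    rw [Nat.choose_eq_zero_of_lt hlt] at hTn
    omega
  -- Integer form of the Lovász parameter: |T| is between C(y, r) and C(y + 1, r). Kruskal–Katona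
  -- gives y^h = O(N), so `h1` forces n = O(y), and `h2` then bounds n.
  set y := Nat.findGreatest (fun y => y.choose r ≤ T.card) n with hy
  have hry : r ≤ y := Nat.le_findGreatest hrn (by simpa using hTpos)
  have hyT : y.choose r ≤ T.card :=
    Nat.findGreatest_spec (P := fun y => y.choose r ≤ T.card) hrn (by simpa using hTpos)
  have hyn : y ≤ n := Nat.findGreatest_le n
  have hKK : y.choose h ≤ N := kruskal_katona_lovasz_form hjr.le hry hyn hT hyT
  have hhpos : 1 ≤ h := by omega
  have hhr : h ≤ r := by omega
  have hNpos : 0 < N := lt_of_lt_of_le (Nat.choose_pos (by omega)) hKK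
  have hyh : y ^ h ≤ r ^ r * r.factorial * N := by
    have h3 : y ≤ h * (y + 1 - h) := by
      obtain ⟨e, he⟩ : ∃ e, y = h + e := ⟨y - h, by omega⟩
      rw [he, show h + e + 1 - h = e + 1 by omega]
      nlinarith
    have h4 := Nat.pow_le_choose (α := ℚ) h y
    rw [div_le_iff₀' (by exact_mod_cast h.factorial_pos)] at h4
    have h5 : (y + 1 - h) ^ h ≤ h.factorial * y.choose h := by exact_mod_cast h4
    calc y ^ h ≤ (h * (y + 1 - h)) ^ h := Nat.pow_le_pow_left h3 h
      _ = h ^ h * (y + 1 - h) ^ h := mul_pow _ _ _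
      _ ≤ r ^ r * (r.factorial * N) := by
          exact Nat.mul_le_mul
            ((Nat.pow_le_pow_left hhr h).trans (Nat.pow_le_pow_right (by omega) hhr))
            (h5.trans (Nat.mul_le_mul (Nat.factorial_le hhr) hKK))
      _ = _ := by ring
  set c := A * 2 ^ r * r ^ r * r.factorial with hc
  have hcpos : 1 ≤ c := Nat.one_le_iff_ne_zero.2 (by
    have := r.factorial_ne_zero
    have : r ≠ 0 := by omega
    positivity)
  have hny : n ≤ c * y := by
    rcases hyn.eq_or_lt with heq | hlt
    · rw [heq]; exact Nat.le_mul_of_pos_left _ hcpos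
    · have hlt' : T.card < (y + 1).choose r := by
        have := Nat.findGreatest_is_greatest (P := fun y => y.choose r ≤ T.card)
          (Nat.lt_succ_self y) hlt
        simpa using this
      have h3 : T.card ≤ 2 ^ r * (y ^ j * y ^ h) := by
        calc T.card ≤ (y + 1) ^ r := hlt'.le.trans (Nat.choose_le_pow _ _)
          _ ≤ (2 * y) ^ r := Nat.pow_le_pow_left (by omega) r
          _ = 2 ^ r * y ^ r := mul_pow _ _ _
          _ = _ := by rw [← pow_add, show j + h = r by omega]
      have h4 : N * n ^ j ≤ N * (c * y ^ j) := by
        calc N * n ^ j ≤ A * (2 ^ r * (y ^ j * (r ^ r * r.factorial * N))) :=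
              h1.trans (by gcongr; exact h3.trans (by gcongr))
          _ = _ := by rw [hc]; ring
      have h5 : n ^ j ≤ (c * y) ^ j := by
        refine (Nat.le_of_mul_le_mul_left h4 hNpos).trans ?_
        rw [mul_pow]
        gcongr
        exact Nat.le_self_pow (by omega) c
      exact le_of_pow_le_pow_left₀ (by omega) (by omega) h5
  have h6 : n ^ (h - 1) * n ≤ n ^ (h - 1) * (c ^ r * (r ^ r * r.factorial) * C) := by
    calc n ^ (h - 1) * n = n ^ h := by rw [← pow_succ, Nat.sub_add_cancel hhpos]
      _ ≤ (c * y) ^ h := Nat.pow_le_pow_left hny h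
      _ = c ^ h * y ^ h := mul_pow _ _ _
      _ ≤ c ^ r * (r ^ r * r.factorial * (C * n ^ (h - 1))) := by
          gcongr
          · exact hyh.trans (by gcongr)
      _ = _ := by ring
  exact Nat.le_of_mul_le_mul_left h6 (Nat.pow_pos (by omega))

theorem exists_forall_card_le {k d p : ℕ} {a : Fin p → ℕ} (hp : 2 ≤ p) (hpk : p < k) (hd : p ≤ d)
    (ha : ∀ i, 0 < a i) (hak : ∑ i, a i = k) :
    ∃ n₀ : ℕ, ∀ n, n₀ ≤ n → ∀ H : Finset (Finset (Fin n)), H ⊆ powersetCard k univ →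
      VecFree a d H →
        H.card ≤ (n - 1).choose (k - 1) ∧ (H.card = (n - 1).choose (k - 1) → IsStar H) := by
  obtain ⟨i, hi⟩ := exists_two_le_part hpk hak
  have hik := part_lt hp ha hak i
  set K := k * (d + 1) with hK
  set r := k - 1 with hr
  set j := a i - 1 with hj
  set C₁ := (k + 1) * (2 ^ (k - 2) * (K * K) + K * K + 1) with hC₁
  set C₂ := 4 ^ r * (C₁ + 1) * (2 ^ r * r.factorial) + r with hC₂
  set C₃ := 4 ^ k * k.factorial * 2 ^ k * (1 + 4 ^ k * k.factorial * 2 ^ k) with hC₃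
  -- The first summand serves the counting lemmas; the rest exceeds the bound of
  -- `le_of_card_shadow_le`.
  refine ⟨4 * (K + k + 1) +
    ((C₃ * K) * 2 ^ r * r ^ r * r.factorial) ^ r * (r ^ r * r.factorial) * (C₃ * C₂) + 1,
    fun n hn H hHk hfree => ?_⟩
  have hH : ∀ F ∈ H, F.card = k := fun F hF => (mem_powersetCard.1 (hHk hF)).2
  suffices hstar : (n - 1).choose (k - 1) ≤ H.card →
      IsStar H ∧ H.card ≤ (n - 1).choose (k - 1) by
    refine ⟨?_, fun h => (hstar h.ge).1⟩
    by_contra! hlt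
    exact absurd (hstar hlt.le).2 (Nat.not_le.2 hlt)
  intro hlarge
  have hcard : Fintype.card (Fin n) = n := Fintype.card_fin n
  obtain ⟨S, f, hS, hSf, hSc⟩ := exists_core_vertices hp hpk hH ha hak hd hfree
    (by rw [hcard]; omega) (by rw [hcard]; exact hlarge)
  rw [hcard] at hSc
  obtain ⟨x, hx⟩ := exists_dominant_value (j := j) (C := C₁) (r := r) (by omega) (by omega) S hS f
    (fun T hT => (hSf T hT).1) (by
      intro T hT T' hT' hTT
      by_contra! hcon
      obtain ⟨h1, h2, h3⟩ := hcon
      refine (hSf T hT).2.2.not_vecFree_of_singleton hp hH ha hak hd (hSf T hT).2.1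
        (hSf T' hT').2.1 (by rw [mem_insert, not_or]; exact ⟨h1, h2⟩) (i := i) ?_ hfree
      rw [insert_inter_of_notMem (by rw [mem_insert, not_or]; exact ⟨h1, h2⟩),
        inter_insert_of_notMem h3, hTT]
      omega)
    (by
      rw [hcard]
      refine hSc.trans ?_
      gcongr
      exact (Nat.choose_le_pow _ _).trans (by rw [show k - 2 = r - 1 by omega]))
    (by rw [hcard]; omega)
  rw [hcard] at hx
  set P : Finset (Finset (Fin n)) := powersetCard (k - 1) (univ.erase x) with hP
  set Mis := P.filter fun T => insert x T ∉ H with hMis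
  have hMisc : Mis.card ≤ C₂ * n ^ (r - 1) := by
    refine le_trans (card_le_card fun T hT => ?_) hx
    obtain ⟨hTP, hTH⟩ := mem_filter.1 hT
    refine mem_filter.2 ⟨mem_powersetCard.2 ⟨subset_univ _, (mem_powersetCard.1 hTP).2⟩, ?_⟩
    rintro ⟨hTS, rfl⟩
    exact hTH (hSf T hTS).2.1
  set B := H.filter fun E => x ∉ E with hB
  have hlink : (H.filter fun E => x ∈ E).card = (P.filter fun T => insert x T ∈ H).card := by
    refine card_nbij' (fun E => E.erase x) (fun T => insert x T) ?_ ?_ ?_ ?_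
    · intro E hE
      obtain ⟨hEH, hxE⟩ := mem_filter.1 hE
      refine mem_coe.2 (mem_filter.2 ⟨mem_powersetCard.2 ⟨erase_subset_erase _ (subset_univ _),
        by rw [card_erase_of_mem hxE, hH E hEH]⟩, by rwa [insert_erase hxE]⟩)
    · intro T hT
      exact mem_coe.2 (mem_filter.2 ⟨(mem_filter.1 hT).2, mem_insert_self _ _⟩)
    · intro E hE
      exact insert_erase (mem_filter.1 hE).2
    · intro T hT
      have := (mem_powersetCard.1 (mem_filter.1 hT).1).1
      exact erase_insert fun h => (mem_erase.1 (this h)).1 rfl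
  have hPc : (P.filter fun T => insert x T ∈ H).card + Mis.card = (n - 1).choose (k - 1) := by
    rw [hMis, card_filter_add_card_filter_not, hP, card_powersetCard, card_erase_of_mem (mem_univ _),
      card_univ, hcard]
  have hHc : (H.filter fun E => x ∈ E).card + B.card = H.card := card_filter_add_card_filter_not _
  have hBempty : B = ∅ := by
    by_contra hBne
    have hBk : ∀ E ∈ B, E.card = k := fun E hE => hH E (mem_filter.1 hE).1
    have hBsize : (B : Set (Finset (Fin n))).Sized k := fun E hE => hBk E hE
    have hBsh := (hfree.mono (filter_subset _ _)).card_le_mul_card_shadow (by omega) ha hak hd B hBk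
    obtain ⟨E, hE⟩ := nonempty_iff_ne_empty.2 hBne
    have hne : (∂ B).Nonempty := by
      rw [← card_pos]
      by_contra! h0
      have := card_pos.2 ⟨E, hE⟩
      rw [Nat.le_zero.1 h0] at hBsh
      omega
    have hiter : ∂^[j] (∂ B) = ∂^[j + 1] B := by rw [Function.iterate_succ_apply]
    have hshadow := card_shadow_mul_pow_le hp hH ha hak hd hfree x i (by rw [hcard]; omega)
      (∂^[j] (∂ B)) (by
        intro R hR
        rw [hiter] at hR
        refine ⟨by rw [hBsize.shadow_iterate hR]; omega, ?_⟩
        obtain ⟨E, hE, hRE, -⟩ := mem_shadow_iterate_iff_exists_sdiff.1 hR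
        exact ⟨E, (mem_filter.1 hE).1, (mem_filter.1 hE).2, hRE⟩)
    rw [hcard] at hshadow
    have hnpos : 0 < n := by omega
    have := le_of_card_shadow_le (A := C₃ * K) (C := C₃ * C₂) (r := r) (j := j) (by omega) (by omega)
      (Nat.one_le_iff_ne_zero.2 (by
        have := k.factorial_ne_zero
        have : k ≠ 0 := by omega
        positivity)) (∂ B) hBsize.shadow hne
      (hshadow.trans (by
        -- This is where `hlarge` enters: |H| = C(n-1, k-1) - |Mis| + |B|.
        have h1 : Mis.card ≤ B.card := by omega
        exact (Nat.mul_le_mul_left C₃ (h1.trans hBsh)).trans (mul_assoc _ _ _).ge))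
      (by
        have h1 : n ^ j * (∂^[j] (∂ B)).card ≤ n ^ j * (C₃ * C₂ * n ^ (r - j - 1)) := by
          calc n ^ j * (∂^[j] (∂ B)).card = (∂^[j] (∂ B)).card * n ^ j := mul_comm _ _
            _ ≤ C₃ * (C₂ * n ^ (r - 1)) := hshadow.trans (by gcongr)
            _ = C₃ * (C₂ * (n ^ (r - j - 1) * n ^ j)) := by
              rw [← pow_add, show r - j - 1 + j = r - 1 by omega]
            _ = _ := by ring
        exact Nat.le_of_mul_le_mul_left h1 (Nat.pow_pos hnpos))
    omega
  rw [hBempty, card_empty] at hHc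
  refine ⟨⟨x, fun E hE => ?_⟩, by omega⟩
  by_contra hxE
  have : E ∈ B := mem_filter.2 ⟨hE, hxE⟩
  rw [hBempty] at this
  simp at this

end

theorem theorem1p4 (k d : ℕ) :
    ∃ n₀ : ℕ, ∀ (p : ℕ), 2 ≤ p → p < k → p ≤ d →
      ∀ a : Fin p → ℕ, (∀ i, 0 < a i) → ∑ i, a i = k →
        ∀ n : ℕ, n₀ ≤ n →
          ∀ H : Finset (Finset (Fin n)), H ⊆ Finset.powersetCard k Finset.univ →
            (¬ ∃ F : Finset (Finset (Fin n)), F ⊆ H ∧ IsVecNumDeltaSystem a d F) →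
              H.card ≤ (n - 1).choose (k - 1) ∧
                (H.card = (n - 1).choose (k - 1) → IsStar H) := by
  have h : ∀ (p : ℕ) (a : Fin p → ℕ), ∃ n₀ : ℕ, 2 ≤ p → p < k → p ≤ d → (∀ i, 0 < a i) →
      ∑ i, a i = k → ∀ n, n₀ ≤ n → ∀ H : Finset (Finset (Fin n)),
        H ⊆ Finset.powersetCard k Finset.univ → VecFree a d H →
          H.card ≤ (n - 1).choose (k - 1) ∧
            (H.card = (n - 1).choose (k - 1) → IsStar H) := by
    intro p a
    by_cases h : 2 ≤ p ∧ p < k ∧ p ≤ d ∧ (∀ i, 0 < a i) ∧ ∑ i, a i = k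
    · obtain ⟨h1, h2, h3, h4, h5⟩ := h
      obtain ⟨n₀, hn₀⟩ := exists_forall_card_le h1 h2 h3 h4 h5
      exact ⟨n₀, fun _ _ _ _ _ => hn₀⟩
    · exact ⟨0, fun h1 h2 h3 h4 h5 => absurd ⟨h1, h2, h3, h4, h5⟩ h⟩
  choose N hN using h
  -- For fixed `k` only finitely many `p` and `a` are admissible, so the maximum of their thresholds
  -- is uniform.
  refine ⟨(Finset.range k).sup fun p =>
    (Fintype.piFinset fun _ : Fin p => Finset.range (k + 1)).sup (N p), ?_⟩
  intro p hp hpk hd a ha hak n hn H hH hfree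
  refine hN p a hp hpk hd ha hak n (le_trans ?_ hn) H hH hfree
  refine le_trans ?_ (Finset.le_sup (Finset.mem_range.2 hpk))
  refine Finset.le_sup (f := N p) ?_
  rw [Fintype.mem_piFinset]
  intro i
  rw [Finset.mem_range]
  have := part_lt hp ha hak i
  omega
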